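/- Fix a constant $\varepsilon\in(0,1/e]$. There exist a randomized algorithm $A$, a polynomial $p$ and a sequence $\eta(n)\to 0$ (all depending only on $\varepsilon$) such that the following holds for every finite ground set $\mathcal N$ of size $n$, every non-negative monotone submodular function $f\colon 2^{\mathcal N}\to\mathbb R_{\ge 0}$ and every solvable convex set $\mathcal P\subseteq[0,1]^{\mathcal N}$ (not necessarily down-closed). Let $F(x)=\sum_{S\subseteq\mathcal N}f(S)\prod_{u\in S}x_u\prod_{u\in\mathcal N\setminus S}(1-x_u)$ be the multilinear extension of $f$. Solvable means that linear functions can be optimized over $\mathcal P$: the algorithm has an oracle that, given $w\in\mathbb R^{\mathcal N}$, returns a point of $\mathcal P$ maximizing $\langle w,\cdot\rangle$ over $\mathcal P$; it accesses $f$ only through a value oracle, and otherwise uses fair coin flips and real arithmetic and comparisons at unit cost (with $\varepsilon$ and $\ln(1/\varepsilon)$ available as constants). The algorithm always stops within $p(n)$ steps and always outputs a vector $x\in[0,1]^{\mathcal N}$ for which there are $y_1,y_2\in\mathcal P$ with $y_1\le x\le \ln(1/\varepsilon)\cdot y_2$ coordinate-wise. Moreover, if $OPT$ maximizes $f$ among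 the sets $S\subseteq\mathcal N$ whose characteristic vector lies in $\mathcal P$ (assuming that there are such sets), then $$\mathbb E[F(x)]\ \ge\ (1-\varepsilon-\eta(n))\cdot f(OPT).$$ That is, $A$ is a polynomial-time $(1-\varepsilon-o(1),\ln(1/\varepsilon))$-bicriteria integer-approximation algorithm for this problem. -/

import Mathlib

open Filter Topology
open scoped BigOperators

/-! ## Submodular functions, the multilinear extension and the optimization problem -/

/-- Submodularity of a set function on a finite ground set. -/
def IsSubmodular {n : ℕ} (f : Finset (Fin n) → ℝ) : Prop :=
  ∀ A B : Finset (Fin n), f (A ∪ B) + f (A ∩ B) ≤ f A + f B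

/-- The multilinear extension `F(x) = ∑_S f(S) ∏_{u ∈ S} x_u ∏_{u ∉ S} (1 - x_u)`. -/
def multilinearExtension {n : ℕ} (f : Finset (Fin n) → ℝ) (x : Fin n → ℝ) : ℝ :=
  ∑ S : Finset (Fin n), f S * ((∏ u ∈ S, x u) * ∏ u ∈ Sᶜ, (1 - x u))

/-- The characteristic vector of a set. -/
def charVec {n : ℕ} (S : Finset (Fin n)) : Fin n → ℝ :=
  fun u => if u ∈ S then 1 else 0

/-- `O` is a best feasible integral solution: it maximizes `f` over `{S | 1_S ∈ P}`. -/
def IsIntegralOptimum {n : ℕ} (f : Finset (Fin n) → ℝ) (P : Set (Fin n → ℝ))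
    (O : Finset (Fin n)) : Prop :=
  charVec O ∈ P ∧ ∀ S : Finset (Fin n), charVec S ∈ P → f S ≤ f O

/-- The vectors of the cube that a fractional algorithm of infeasibility ratio `β` may output. -/
def WithinInfeasibility {n : ℕ} (β : ℝ) (P : Set (Fin n → ℝ)) (x : Fin n → ℝ) : Prop :=
  x ∈ Set.Icc (0 : Fin n → ℝ) 1 ∧ ∃ y₁ ∈ P, ∃ y₂ ∈ P, y₁ ≤ x ∧ x ≤ β • y₂

/-- `opt` optimizes linear functions over `P`: given `w`, it returns a point of `P`
maximizing `⟨w, ·⟩`.  A solvable convex set is given to algorithms through such an oracle. -/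
def IsLinearOptimizer {n : ℕ} (P : Set (Fin n → ℝ)) (opt : (Fin n → ℝ) → (Fin n → ℝ)) : Prop :=
  ∀ w : Fin n → ℝ, opt w ∈ P ∧ ∀ y ∈ P, ∑ u, w u * y u ≤ ∑ u, w u * opt w u

/-! ## Machine model

A randomized real RAM with oracles.  It has natural-number registers (used for counting and
addressing), arrays of real cells, fair coin flips, a value oracle for `f` and a linear
optimization oracle for `P`.  A program is a finite piece of syntax that does not depend on the
instance.  There is no rounding of reals and no multiplication of naturals, the only literals are
natural numbers, and the only loops are counted loops, so every run terminates. -/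

/-- A real cell: entry `N[idx]` of the real array number `arr`, where `N[idx]` is the content of
the natural-number register `idx`. -/
structure Cell where
  arr : ℕ
  idx : ℕ

/-- The arithmetic operations on reals. -/
inductive RealOp
  | add
  | sub
  | mul
  | div

/-- The result of an arithmetic operation (dividing by zero gives zero). -/
noncomputable def RealOp.apply : RealOp → ℝ → ℝ → ℝ
  | .add, a, b => a + b
  | .sub, a, b => a - b
  | .mul, a, b => a * b
  | .div, a, b => a / b

/-- Programs.  Registers and arrays are named by natural numbers. -/
inductive Prog
  /-- do nothing -/
  | skip
  /-- run `p`, then `q` -/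
  | seq (p q : Prog)
  /-- `N[r] := k` -/
  | natConst (r k : ℕ)
  /-- `N[r] := N[s] + N[t]` -/
  | natAdd (r s t : ℕ)
  /-- `N[r] := max (N[s] - N[t]) 0` -/
  | natSub (r s t : ℕ)
  /-- `d := N[r]`, as a real number -/
  | realOfNat (d : Cell) (r : ℕ)
  /-- `d := a op b` -/
  | realArith (op : RealOp) (d a b : Cell)
  /-- `d :=` a fair random bit -/
  | flip (d : Cell)
  /-- `d := f(S)`, where `S` is the set of the elements `u` at which array `a` is positive -/
  | queryValue (d : Cell) (a : ℕ)
  /-- the first `n` entries of array `b` become a maximizer over `P` of the linear function whose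
  coefficients are the first `n` entries of array `a` -/
  | queryOpt (b a : ℕ)
  /-- `if N[r] ≤ N[s] then p else q` -/
  | ifNatLE (r s : ℕ) (p q : Prog)
  /-- `if a ≤ b then p else q`, for real cells -/
  | ifRealLE (a b : Cell) (p q : Prog)
  /-- `for N[i] = 0, 1, …, N[r] - 1 do p`, where `N[r]` is read once, before the loop -/
  | forLoop (i r : ℕ) (p : Prog)

/-- The state of the machine: registers, real arrays, the number of coins flipped so far, and the
number of steps made so far. -/
structure MState where
  nat : ℕ → ℕ
  real : ℕ → ℕ → ℝ
  coins : ℕ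
  time : ℕ

namespace MState

/-- Let `k` steps pass. -/
def tick (s : MState) (k : ℕ) : MState := { s with time := s.time + k }

def setNat (s : MState) (r v : ℕ) : MState := { s with nat := Function.update s.nat r v }

def readCell (s : MState) (c : Cell) : ℝ := s.real c.arr (s.nat c.idx)

def setArr (s : MState) (a : ℕ) (v : ℕ → ℝ) : MState :=
  { s with real := Function.update s.real a v }

def setCell (s : MState) (c : Cell) (v : ℝ) : MState :=
  s.setArr c.arr (Function.update (s.real c.arr) (s.nat c.idx) v)

/-- The first `n` entries of an array, as a vector. -/
def vec (s : MState) (n a : ℕ) : Fin n → ℝ := fun u => s.real a u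

/-- Overwrite the first `n` entries of an array by a vector. -/
def setVec {n : ℕ} (s : MState) (a : ℕ) (x : Fin n → ℝ) : MState :=
  s.setArr a (fun j => if h : j < n then x ⟨j, h⟩ else s.real a j)

end MState

open Classical in
/-- Execution of a program, with value oracle `f`, linear optimization oracle `opt` and coin
tosses `ω`.  An oracle call costs `n + 1` steps (its query is a set or a vector on `n` elements),
and every other instruction, test, and loop iteration costs one step. -/
noncomputable def Prog.exec {n : ℕ} (f : Finset (Fin n) → ℝ) (opt : (Fin n → ℝ) → (Fin n → ℝ))
    (ω : ℕ → Bool) : Prog → MState → MState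
  | .skip, s => s.tick 1
  | .seq p q, s => q.exec f opt ω (p.exec f opt ω s)
  | .natConst r k, s => (s.setNat r k).tick 1
  | .natAdd r a b, s => (s.setNat r (s.nat a + s.nat b)).tick 1
  | .natSub r a b, s => (s.setNat r (s.nat a - s.nat b)).tick 1
  | .realOfNat d r, s => (s.setCell d (s.nat r : ℝ)).tick 1
  | .realArith op d a b, s => (s.setCell d (op.apply (s.readCell a) (s.readCell b))).tick 1
  | .flip d, s =>
      { (s.setCell d (if ω s.coins then 1 else 0)).tick 1 with coins := s.coins + 1 }
  | .queryValue d a, s =>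
      (s.setCell d (f (Finset.univ.filter fun u => 0 < s.vec n a u))).tick (n + 1)
  | .queryOpt b a, s => (s.setVec b (opt (s.vec n a))).tick (n + 1)
  | .ifNatLE r t p q, s =>
      if s.nat r ≤ s.nat t then p.exec f opt ω (s.tick 1) else q.exec f opt ω (s.tick 1)
  | .ifRealLE a b p q, s =>
      if s.readCell a ≤ s.readCell b then p.exec f opt ω (s.tick 1)
      else q.exec f opt ω (s.tick 1)
  | .forLoop i r p, s =>
      (List.range (s.nat r)).foldl
        (fun s' k => p.exec f opt ω ((s'.setNat i k).tick 1)) (s.tick 1)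

/-- The state at the start of a run: register `0` holds `n`, the constants `c₀, c₁` given to the
program are the entries `0, 1` of array `0`, and everything else is zero. -/
def MState.start (n : ℕ) (c₀ c₁ : ℝ) : MState where
  nat := fun r => if r = 0 then n else 0
  real := fun a j => if a = 0 ∧ j = 0 then c₀ else if a = 0 ∧ j = 1 then c₁ else 0
  coins := 0
  time := 0

/-- An infinite coin sequence that starts with the given `m` coins (a run that makes at most `m`
steps never reads beyond them). -/
def extendCoins {m : ℕ} (ω : Fin m → Bool) : ℕ → Bool :=
  fun i => if h : i < m then ω ⟨i, h⟩ else false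

/-- The final state of the run of `A` with the constants `c₀, c₁` and the coins `ω`. -/
noncomputable def Prog.run (A : Prog) {n : ℕ} (f : Finset (Fin n) → ℝ)
    (opt : (Fin n → ℝ) → (Fin n → ℝ)) (c₀ c₁ : ℝ) {m : ℕ} (ω : Fin m → Bool) : MState :=
  A.exec f opt (extendCoins ω) (MState.start n c₀ c₁)

/-- The number of steps of the run. -/
noncomputable def Prog.runTime (A : Prog) {n : ℕ} (f : Finset (Fin n) → ℝ)
    (opt : (Fin n → ℝ) → (Fin n → ℝ)) (c₀ c₁ : ℝ) {m : ℕ} (ω : Fin m → Bool) : ℕ :=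
  (A.run f opt c₀ c₁ ω).time

/-- The output vector of the run, written by the program into array `1`. -/
noncomputable def Prog.output (A : Prog) {n : ℕ} (f : Finset (Fin n) → ℝ)
    (opt : (Fin n → ℝ) → (Fin n → ℝ)) (c₀ c₁ : ℝ) {m : ℕ} (ω : Fin m → Bool) : Fin n → ℝ :=
  (A.run f opt c₀ c₁ ω).vec n 1

/-- `A`, given the constants `c₀, c₁`, is a (randomized) `(α, β)`-bicriteria integer-approximation
algorithm, running in time `t`, for maximizing the multilinear extension of a non-negative monotone
submodular function over a solvable convex subset of the cube.  Here `α` and `t` depend on the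
size `n` of the ground set.  Time bound and infeasibility bound hold for all coin tosses; the
approximation guarantee is in expectation over `t n` independent fair coins, which is as many as a
run can use. -/
def IsBicriteriaIntegerApprox (A : Prog) (c₀ c₁ : ℝ) (t : ℕ → ℕ) (α : ℕ → ℝ) (β : ℝ) : Prop :=
  ∀ (n : ℕ) (f : Finset (Fin n) → ℝ) (P : Set (Fin n → ℝ)) (opt : (Fin n → ℝ) → (Fin n → ℝ)),
    (∀ S, 0 ≤ f S) → Monotone f → IsSubmodular f →
    P ⊆ Set.Icc 0 1 → Convex ℝ P → IsLinearOptimizer P opt →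
      (∀ ω : Fin (t n) → Bool, A.runTime f opt c₀ c₁ ω ≤ t n) ∧
      (∀ ω : Fin (t n) → Bool, WithinInfeasibility β P (A.output f opt c₀ c₁ ω)) ∧
      (∀ O : Finset (Fin n), IsIntegralOptimum f P O →
        α n * f O ≤
          𝔼 ω : Fin (t n) → Bool, multilinearExtension f (A.output f opt c₀ c₁ ω))

/-! ## Frame rules and the loop rule of the machine model -/

/-! The algorithm is continuous greedy with sampled weights, run up to time T = ln(1/ε) instead of
time 1 and truncated to the cube only at the end. It makes k = (n+1)² rounds with step δ = T/k. In
each round it estimates, for every element u, the expected marginal w_u(x) = E[f(R(x) ∪ u) -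
f(R(x))], where R(x) contains each v independently with probability x_v, asks the oracle for a
maximizer y over P of these weights, and adds δy to the current point.

Infeasibility: before truncation the final point is T times an average of oracle answers, hence T·y
with y ∈ P by convexity. Since ε ≤ 1/e gives T ≥ 1, y ≤ min(Ty, 1) ≤ Ty, so one point of P serves as
both bounds and P need not be down-closed.

Value: submodularity gives f(O) ≤ F(x) + ∑_{u ∈ O} w_u(x), so exact weights would give ⟨y, w⟩ ≥ f(O)
- F(x). Adding δy gains at least κ⟨y, w⟩ with κ = δ(1 - δn) (`le_multilinearExtension_step`), so the
gap to f(O) shrinks by the factor 1 - κ per round, and (1 - κ)^k ≤ e^{-T + o(1)} = ε(1 + o(1)).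

Sampling error: each weight has mean error at most f(u | ∅)/q for q² samples, plus a rounding error
from dyadic thresholds. The total is controlled by M = ∑_u c_u f(u | ∅), where c_u is the largest
u-coordinate over P (`singletonBound`). As P is not down-closed, f({u}) need not be at most f(O), so
M is compared with the output instead. At x = 0 every sample is empty, so the first oracle call uses
exact weights and already secures κM/n (`singletonBound_le_greedy`). With q = (n+1)⁴ the error is
therefore O(1/n) times the expected output value; if that value exceeds f(O) there is nothing to
prove, and otherwise the error is O(1/n)·f(O).

On the machine side, loop invariants and frame rules identify the output with the recursion `greedy`
and compute the running time exactly (`greedyProg_exec`). -/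

/-- `p.WritesNat r`: the program text contains an assignment to the register `r`. -/
def Prog.WritesNat : Prog → ℕ → Prop
  | .seq p q, x => p.WritesNat x ∨ q.WritesNat x
  | .natConst r _, x => x = r
  | .natAdd r _ _, x => x = r
  | .natSub r _ _, x => x = r
  | .ifNatLE _ _ p q, x => p.WritesNat x ∨ q.WritesNat x
  | .ifRealLE _ _ p q, x => p.WritesNat x ∨ q.WritesNat x
  | .forLoop i _ p, x => x = i ∨ p.WritesNat x
  | _, _ => False

/-- `p.WritesArr a`: the program text contains an assignment to the array `a`. -/
def Prog.WritesArr : Prog → ℕ → Prop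
  | .seq p q, x => p.WritesArr x ∨ q.WritesArr x
  | .realOfNat d _, x => x = d.arr
  | .realArith _ d _ _, x => x = d.arr
  | .flip d, x => x = d.arr
  | .queryValue d _, x => x = d.arr
  | .queryOpt b _, x => x = b
  | .ifNatLE _ _ p q, x => p.WritesArr x ∨ q.WritesArr x
  | .ifRealLE _ _ p q, x => p.WritesArr x ∨ q.WritesArr x
  | .forLoop _ _ p, x => p.WritesArr x
  | _, _ => False

section Machine

variable {n : ℕ} (f : Finset (Fin n) → ℝ) (opt : (Fin n → ℝ) → (Fin n → ℝ)) (ω : ℕ → Bool)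

/-- Invariant rule for counted loops. -/
theorem Prog.exec_forLoop_induction (I : ℕ → MState → Prop) (i r : ℕ) (p : Prog) (s : MState)
    (h0 : I 0 (s.tick 1))
    (hstep : ∀ k < s.nat r, ∀ s', I k s' → I (k + 1) (p.exec f opt ω ((s'.setNat i k).tick 1))) :
    I (s.nat r) ((Prog.forLoop i r p).exec f opt ω s) := by
  have key : ∀ N ≤ s.nat r, I N ((List.range N).foldl
      (fun s' k => p.exec f opt ω ((s'.setNat i k).tick 1)) (s.tick 1)) := by
    intro N
    induction N with
    | zero => intro _; simpa using h0
    | succ N ih =>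
      intro hN
      rw [List.range_succ, List.foldl_append]
      exact hstep N (by omega) _ (ih (by omega))
  exact key _ le_rfl

theorem Prog.exec_nat_of_not_writesNat (p : Prog) (x : ℕ) (h : ¬ p.WritesNat x) (s : MState) :
    (p.exec f opt ω s).nat x = s.nat x := by
  induction p generalizing s with
  | seq p q ihp ihq =>
    simp only [WritesNat, not_or] at h
    rw [exec, ihq h.2, ihp h.1]
  | ifNatLE r t p q ihp ihq =>
    simp only [WritesNat, not_or] at h
    rw [exec]
    split_ifs
    · rw [ihp h.1]; rfl
    · rw [ihq h.2]; rfl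
  | ifRealLE r t p q ihp ihq =>
    simp only [WritesNat, not_or] at h
    rw [exec]
    split_ifs
    · rw [ihp h.1]; rfl
    · rw [ihq h.2]; rfl
  | forLoop i r p ih =>
    simp only [WritesNat, not_or] at h
    refine exec_forLoop_induction f opt ω (fun _ s' => s'.nat x = s.nat x) i r p s rfl ?_
    intro k _ s' hs'
    rw [ih h.2]
    simp [MState.tick, MState.setNat, Function.update_of_ne h.1, hs']
  | natConst | natAdd | natSub =>
    simp only [WritesNat] at h
    simp [exec, MState.tick, MState.setNat, Function.update_of_ne h]
  | _ => rfl

theorem Prog.exec_real_of_not_writesArr (p : Prog) (x : ℕ) (h : ¬ p.WritesArr x) (s : MState) :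
    (p.exec f opt ω s).real x = s.real x := by
  induction p generalizing s with
  | seq p q ihp ihq =>
    simp only [WritesArr, not_or] at h
    rw [exec, ihq h.2, ihp h.1]
  | ifNatLE r t p q ihp ihq =>
    simp only [WritesArr, not_or] at h
    rw [exec]
    split_ifs
    · rw [ihp h.1]; rfl
    · rw [ihq h.2]; rfl
  | ifRealLE r t p q ihp ihq =>
    simp only [WritesArr, not_or] at h
    rw [exec]
    split_ifs
    · rw [ihp h.1]; rfl
    · rw [ihq h.2]; rfl
  | forLoop i r p ih =>
    simp only [WritesArr] at h
    refine exec_forLoop_induction f opt ω (fun _ s' => s'.real x = s.real x) i r p s rfl ?_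
    intro k _ s' hs'
    rw [ih h]
    exact hs'
  | realOfNat | realArith | flip | queryValue | queryOpt =>
    simp only [WritesArr] at h
    simp [exec, MState.tick, MState.setCell, MState.setVec, MState.setArr, Function.update_of_ne h]
  | _ => rfl

end Machine

/-! ## The program: sampled continuous greedy

Registers: `0` holds `n`, `1` holds `1`, `3` the number of rounds `k = (n + 1) ^ 2`, `5` the number
`k ^ 4` of samples per round and of coins per threshold, `10` holds `0`, `6`-`9` and `11` are
loop counters.  Arrays: `1` holds the current point, `3` the sample, `4` the weights, `5` the
oracle's answer; entry `0` of `2`, `6`-`11` are scalar variables (`2` is the step size). -/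

/-- `N[r] := N[s] * N[t]`. -/
def mulProg (r s t : ℕ) : Prog :=
  .seq (.natConst r 0) (.forLoop 11 s (.natAdd r r t))

/-- The step size is `c₁ / k`, so only the second of the two given constants is read. Register 12 is
used to create the real divisor 2. -/
def setupProg : Prog :=
  .seq (.natConst 1 1) <| .seq (.natAdd 2 0 1) <| .seq (mulProg 3 2 2) <| .seq (mulProg 4 3 3) <|
  .seq (mulProg 5 4 4) <| .seq (.natAdd 12 1 1) <| .seq (.realOfNat ⟨8, 10⟩ 12) <|
  .seq (.realOfNat ⟨2, 10⟩ 3) (.realArith .div ⟨2, 10⟩ ⟨0, 1⟩ ⟨2, 10⟩)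

/-- Draw a random dyadic threshold. -/
def thresholdProg : Prog :=
  .seq (.realOfNat ⟨6, 10⟩ 1) <| .forLoop 9 5 <|
  .seq (.flip ⟨7, 10⟩) <| .seq (.realArith .add ⟨6, 10⟩ ⟨6, 10⟩ ⟨7, 10⟩)
    (.realArith .div ⟨6, 10⟩ ⟨6, 10⟩ ⟨8, 10⟩)

/-- Draw a random set. -/
def sampleProg : Prog :=
  -- Only the sign of the entry matters, because `queryValue` collects the elements with positive
  -- entries.
  .forLoop 8 0 <| .seq thresholdProg (.realArith .sub ⟨3, 8⟩ ⟨1, 8⟩ ⟨6, 10⟩)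

/-- Add the marginals with respect to the current sample to the weights. -/
def marginalsProg : Prog :=
  .seq (.queryValue ⟨9, 10⟩ 3) <| .forLoop 8 0 <|
  -- Cell `⟨12, 10⟩` is always zero, so adding it copies a real. The entry of u is saved, set to 1
  -- to force u into the queried set, and restored at the end.
  .seq (.realArith .add ⟨11, 10⟩ ⟨3, 8⟩ ⟨12, 10⟩) <| .seq (.realOfNat ⟨3, 8⟩ 1) <|
  .seq (.queryValue ⟨10, 10⟩ 3) <| .seq (.realArith .sub ⟨10, 10⟩ ⟨10, 10⟩ ⟨9, 10⟩) <|
  .seq (.realArith .add ⟨4, 8⟩ ⟨4, 8⟩ ⟨10, 10⟩) (.realArith .add ⟨3, 8⟩ ⟨11, 10⟩ ⟨12, 10⟩)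

/-- Estimate the (scaled) weights by sampling. -/
def estimateProg : Prog :=
  .seq (.forLoop 8 0 (.realOfNat ⟨4, 8⟩ 10)) <| .forLoop 7 5 <| .seq sampleProg marginalsProg

/-- Move in the direction of the oracle's answer. -/
def moveProg : Prog :=
  .seq (.queryOpt 5 4) <| .forLoop 8 0 <|
  .seq (.realArith .mul ⟨10, 10⟩ ⟨2, 10⟩ ⟨5, 8⟩) (.realArith .add ⟨1, 8⟩ ⟨1, 8⟩ ⟨10, 10⟩)

/-- Both branches cost one step, which keeps the running time independent of the data. -/
def truncateProg : Prog :=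
  .forLoop 8 0 <| .seq (.realOfNat ⟨10, 10⟩ 1)
    (.ifRealLE ⟨1, 8⟩ ⟨10, 10⟩ .skip (.realOfNat ⟨1, 8⟩ 1))

def greedyProg : Prog :=
  .seq setupProg <| .seq (.forLoop 6 3 (.seq estimateProg moveProg)) truncateProg

/-! ## What the program computes -/

/-- The threshold computed from `b` coins, starting with coin number `c`. -/
noncomputable def dyadic (ω : ℕ → Bool) (c : ℕ) : ℕ → ℝ
  -- Starting from 1 rather than 0 puts the thresholds in (0, 1]: a coordinate 0 is never sampled,
  -- and a coordinate above 1 always is.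
  | 0 => 1
  | b + 1 => (dyadic ω c b + if ω (c + b) then 1 else 0) / 2

/-- The random set sampled at `x`. -/
noncomputable def sampleSet {n : ℕ} (ω : ℕ → Bool) (c l : ℕ) (x : Fin n → ℝ) : Finset (Fin n) :=
  Finset.univ.filter fun u => dyadic ω (c + u * l) l < x u

/-- Averaged over R(x) this is (1 - x_u)·∂F/∂x_u, not the partial derivative itself. -/
def marginal {n : ℕ} (f : Finset (Fin n) → ℝ) (S : Finset (Fin n)) (u : Fin n) : ℝ :=
  f (insert u S) - f S

/-- The sum of the marginals with respect to `m` samples at `x`. -/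
noncomputable def estimate {n : ℕ} (f : Finset (Fin n) → ℝ) (ω : ℕ → Bool) (c m l : ℕ)
    (x : Fin n → ℝ) : Fin n → ℝ :=
  fun u => ∑ j ∈ Finset.range m, marginal f (sampleSet ω (c + j * (n * l)) l x) u

/-- The trajectory of the sampled continuous greedy algorithm, without truncation. -/
noncomputable def greedy {n : ℕ} (f : Finset (Fin n) → ℝ) (opt : (Fin n → ℝ) → (Fin n → ℝ))
    (ω : ℕ → Bool) (δ : ℝ) (m l : ℕ) : ℕ → Fin n → ℝ
  | 0 => 0
  | i + 1 => greedy f opt ω δ m l i +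
      δ • opt (estimate f ω (i * (m * (n * l))) m l (greedy f opt ω δ m l i))

/-! ### Correctness and exact running time of the subprograms -/

section Spec

variable {n : ℕ} (f : Finset (Fin n) → ℝ) (opt : (Fin n → ℝ) → (Fin n → ℝ)) (ω : ℕ → Bool)

theorem mulProg_exec (r s t : ℕ) (σ : MState) (hrs : s ≠ r) (hrt : t ≠ r)
    (hr : r ≠ 11) (ht : t ≠ 11) :
    ((mulProg r s t).exec f opt ω σ).nat r = σ.nat s * σ.nat t ∧
    ((mulProg r s t).exec f opt ω σ).coins = σ.coins ∧
    ((mulProg r s t).exec f opt ω σ).time = σ.time + 2 + σ.nat s * 2 := by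
  have h := Prog.exec_forLoop_induction f opt ω
    (fun k τ => τ.nat r = k * σ.nat t ∧ τ.nat t = σ.nat t ∧ τ.coins = σ.coins ∧
      τ.time = σ.time + 2 + k * 2) 11 s (.natAdd r r t) ((σ.setNat r 0).tick 1)
    (by simp [MState.tick, MState.setNat, hrt]) (by
      rintro k - τ ⟨h1, h2, h3, h4⟩
      simp [Prog.exec, MState.tick, MState.setNat, hrt, hr, ht, h1, h2, h3, h4]
      constructor <;> ring)
  simp only [MState.tick, MState.setNat, Function.update_of_ne hrs] at h
  exact ⟨h.1, h.2.2.1, h.2.2.2⟩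

/-- The registers and scalars that are constant after the setup. -/
structure Ready (n k m : ℕ) (δ : ℝ) (s : MState) : Prop where
  nat0 : s.nat 0 = n
  nat1 : s.nat 1 = 1
  nat3 : s.nat 3 = k
  nat5 : s.nat 5 = m
  nat10 : s.nat 10 = 0
  real2 : s.real 2 0 = δ
  real8 : s.real 8 0 = 2
  real12 : s.real 12 0 = 0

variable {f opt ω}

/-- The two frame rules applied to all constants at once; for a concrete program the side conditions
follow by simplifying its syntax. -/
theorem Ready.exec {k m : ℕ} {δ : ℝ} {s : MState} (h : Ready n k m δ s) (p : Prog)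
    (hn : ∀ r ∈ [0, 1, 3, 5, 10], ¬ p.WritesNat r) (ha : ∀ a ∈ [2, 8, 12], ¬ p.WritesArr a) :
    Ready n k m δ (p.exec f opt ω s) := by
  simp only [List.forall_mem_cons, List.not_mem_nil, false_imp_iff, implies_true, and_true]
    at hn ha
  obtain ⟨h0, h1, h3, h5, h10⟩ := hn
  obtain ⟨a2, a8, a12⟩ := ha
  constructor <;> simp only [Prog.exec_nat_of_not_writesNat, Prog.exec_real_of_not_writesArr, h0,
    h1, h3, h5, h10, a2, a8, a12, not_false_eq_true, h.nat0, h.nat1, h.nat3, h.nat5, h.nat10,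
    h.real2, h.real8, h.real12]

theorem Ready.tick {k m : ℕ} {δ : ℝ} {s : MState} (h : Ready n k m δ s) (t : ℕ) :
    Ready n k m δ (s.tick t) := ⟨h.1, h.2, h.3, h.4, h.5, h.6, h.7, h.8⟩

theorem Ready.setNat {k m : ℕ} {δ : ℝ} {s : MState} (h : Ready n k m δ s) (r v : ℕ)
    (hr : r ∉ [0, 1, 3, 5, 10]) : Ready n k m δ (s.setNat r v) := by
  simp only [List.mem_cons, List.not_mem_nil, or_false, not_or] at hr
  obtain ⟨h0, h1, h3, h5, h10⟩ := hr
  constructor <;> simp [MState.setNat, Function.update_of_ne, Ne.symm, h0, h1, h3, h5, h10,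
    h.nat0, h.nat1, h.nat3, h.nat5, h.nat10, h.real2, h.real8, h.real12]

theorem thresholdProg_exec {k m : ℕ} {δ : ℝ} {s : MState} (h : Ready n k m δ s) :
    (thresholdProg.exec f opt ω s).real 6 0 = dyadic ω s.coins m ∧
    (thresholdProg.exec f opt ω s).coins = s.coins + m ∧
    (thresholdProg.exec f opt ω s).time = s.time + 2 + m * 4 := by
  have h := Prog.exec_forLoop_induction f opt ω
    (fun b τ => τ.real 6 0 = dyadic ω s.coins b ∧ τ.coins = s.coins + b ∧
      τ.time = s.time + 2 + b * 4 ∧ τ.nat 10 = 0 ∧ τ.real 8 0 = 2) 9 5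
    (.seq (.flip ⟨7, 10⟩) <| .seq (.realArith .add ⟨6, 10⟩ ⟨6, 10⟩ ⟨7, 10⟩)
    (.realArith .div ⟨6, 10⟩ ⟨6, 10⟩ ⟨8, 10⟩)) ((Prog.realOfNat ⟨6, 10⟩ 1).exec f opt ω s)
    (by simp [Prog.exec, MState.tick, MState.setCell, MState.setArr, dyadic, h.nat10, h.nat1,
      h.real8]) (by
      rintro b - τ ⟨h1, h2, h3, h4, h5⟩
      simp [Prog.exec, MState.tick, MState.setNat, MState.setCell, MState.setArr,
        MState.readCell, RealOp.apply, h1, h2, h3, h4, h5, dyadic]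
      constructor <;> ring)
  rw [show ((Prog.realOfNat ⟨6, 10⟩ 1).exec f opt ω s).nat 5 = m from ‹Ready n k m δ s›.nat5] at h
  exact ⟨h.1, h.2.1, h.2.2.1⟩

end Spec

section ExecSpec

variable {n : ℕ} {f : Finset (Fin n) → ℝ} {opt : (Fin n → ℝ) → (Fin n → ℝ)} {ω : ℕ → Bool}

theorem setupProg_exec (c₀ c₁ : ℝ) :
    Ready n ((n + 1) ^ 2) ((n + 1) ^ 8) (c₁ / ((n + 1) ^ 2 : ℕ))
      (setupProg.exec f opt ω (MState.start n c₀ c₁)) ∧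
    (setupProg.exec f opt ω (MState.start n c₀ c₁)).real 1 = 0 ∧
    (setupProg.exec f opt ω (MState.start n c₀ c₁)).coins = 0 ∧
    (setupProg.exec f opt ω (MState.start n c₀ c₁)).time
      = 12 + 2 * (n + 1) + 2 * (n + 1) ^ 2 + 2 * (n + 1) ^ 4 := by
  set s₁ := (Prog.natAdd 2 0 1).exec f opt ω
    ((Prog.natConst 1 1).exec f opt ω (MState.start n c₀ c₁)) with hs₁
  set s₂ := (mulProg 3 2 2).exec f opt ω s₁ with hs₂
  set s₃ := (mulProg 4 3 3).exec f opt ω s₂ with hs₃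
  set s₄ := (mulProg 5 4 4).exec f opt ω s₃ with hs₄
  have e₂ := mulProg_exec f opt ω 3 2 2 s₁ (by simp) (by simp) (by simp) (by simp)
  have e₃ := mulProg_exec f opt ω 4 3 3 s₂ (by simp) (by simp) (by simp) (by simp)
  have e₄ := mulProg_exec f opt ω 5 4 4 s₃ (by simp) (by simp) (by simp) (by simp)
  rw [← hs₂] at e₂
  rw [← hs₃] at e₃
  rw [← hs₄] at e₄
  have n12 : s₁.nat 2 = n + 1 := by
    simp [hs₁, Prog.exec, MState.tick, MState.setNat, MState.start]
  have t1 : s₁.time = 2 := by simp [hs₁, Prog.exec, MState.tick, MState.setNat, MState.start]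
  have k1 : s₁.coins = 0 := by simp [hs₁, Prog.exec, MState.tick, MState.setNat, MState.start]
  have F : ∀ r s t x, x ≠ r → x ≠ 11 → ∀ τ, ((mulProg r s t).exec f opt ω τ).nat x = τ.nat x :=
    fun r s t x h1 h2 τ => Prog.exec_nat_of_not_writesNat f opt ω _ x
      (by simp [mulProg, Prog.WritesNat, h1, h2]) τ
  have G : ∀ r s t x τ, ((mulProg r s t).exec f opt ω τ).real x = τ.real x :=
    fun r s t x τ => Prog.exec_real_of_not_writesArr f opt ω _ x
      (by simp [mulProg, Prog.WritesArr]) τ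
  have n23 : s₂.nat 3 = (n + 1) ^ 2 := by rw [e₂.1, n12]; ring
  have n34 : s₃.nat 4 = (n + 1) ^ 4 := by rw [e₃.1, n23]; ring
  have n45 : s₄.nat 5 = (n + 1) ^ 8 := by rw [e₄.1, n34]; ring
  have t4 : s₄.time = 8 + 2 * (n + 1) + 2 * (n + 1) ^ 2 + 2 * (n + 1) ^ 4 := by
    rw [e₄.2.2, e₃.2.2, e₂.2.2, n12, n23, n34, t1]; ring
  have k4 : s₄.coins = 0 := by rw [e₄.2.1, e₃.2.1, e₂.2.1, k1]
  have n43 : s₄.nat 3 = (n + 1) ^ 2 := by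
    rw [hs₄, F _ _ _ _ (by simp) (by simp), hs₃, F _ _ _ _ (by simp) (by simp), n23]
  have n4 : ∀ x, x ≠ 3 → x ≠ 4 → x ≠ 5 → x ≠ 11 → s₄.nat x = s₁.nat x := by
    intro x h3 h4 h5 h11
    rw [hs₄, F _ _ _ _ h5 h11, hs₃, F _ _ _ _ h4 h11, hs₂, F _ _ _ _ h3 h11]
  have n40 := n4 0 (by simp) (by simp) (by simp) (by simp)
  have n41 := n4 1 (by simp) (by simp) (by simp) (by simp)
  have n410 := n4 10 (by simp) (by simp) (by simp) (by simp)
  have r4 : s₄.real = (MState.start n c₀ c₁).real := by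
    funext x
    rw [hs₄, G, hs₃, G, hs₂, G]
    rfl
  simp only [hs₁, Prog.exec, MState.tick, MState.setNat, MState.start, Function.update_apply]
    at n40 n41 n410
  simp only [↓reduceIte, Nat.reduceEqDiff, OfNat.ofNat_ne_zero, zero_ne_one] at n40 n41 n410
  have e : setupProg.exec f opt ω (MState.start n c₀ c₁)
      = (Prog.seq (.natAdd 12 1 1) <| .seq (.realOfNat ⟨8, 10⟩ 12) <|
        .seq (.realOfNat ⟨2, 10⟩ 3) (.realArith .div ⟨2, 10⟩ ⟨0, 1⟩ ⟨2, 10⟩)).exec f opt ω s₄ := rfl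
  rw [e]
  refine ⟨⟨?_, ?_, ?_, ?_, ?_, ?_, ?_, ?_⟩, ?_, ?_, ?_⟩ <;>
    simp [Prog.exec, MState.tick, MState.setNat, MState.setCell, MState.setArr, MState.readCell,
      RealOp.apply, n40, n41, n410, r4, n43, n45, t4, k4, MState.start]
  · rfl
  · ring

theorem sampleProg_exec {k m : ℕ} {δ : ℝ} {s : MState} (h : Ready n k m δ s) :
    (∀ u < n, (sampleProg.exec f opt ω s).real 3 u
      = s.real 1 u - dyadic ω (s.coins + u * m) m) ∧
    (sampleProg.exec f opt ω s).coins = s.coins + n * m ∧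
    (sampleProg.exec f opt ω s).time = s.time + 1 + n * (4 + m * 4) := by
  have H := Prog.exec_forLoop_induction f opt ω
    (fun j τ => Ready n k m δ τ ∧ τ.real 1 = s.real 1 ∧
      (∀ u < j, τ.real 3 u = s.real 1 u - dyadic ω (s.coins + u * m) m) ∧
      τ.coins = s.coins + j * m ∧ τ.time = s.time + 1 + j * (4 + m * 4)) 8 0
    (.seq thresholdProg (.realArith .sub ⟨3, 8⟩ ⟨1, 8⟩ ⟨6, 10⟩)) s
    ⟨h.tick 1, rfl, by simp, by simp [MState.tick], by simp [MState.tick]⟩ (by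
      rintro j - τ ⟨h1, h2, h3, h4, h5⟩
      set τ₁ := (τ.setNat 8 j).tick 1 with hτ₁
      have hR : Ready n k m δ τ₁ := (h1.setNat 8 j (by simp)).tick 1
      obtain ⟨g1, g2, g3⟩ := thresholdProg_exec (f := f) (opt := opt) (ω := ω) hR
      refine ⟨hR.exec _ (by simp [thresholdProg, Prog.WritesNat])
        (by simp [thresholdProg, Prog.WritesArr]), ?_⟩
      rw [Prog.exec]
      have f8 : (thresholdProg.exec f opt ω τ₁).nat 8 = j := by
        rw [Prog.exec_nat_of_not_writesNat _ _ _ _ _ (by simp [thresholdProg, Prog.WritesNat])]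
        simp [hτ₁, MState.tick, MState.setNat]
      have f10 : (thresholdProg.exec f opt ω τ₁).nat 10 = 0 := by
        rw [Prog.exec_nat_of_not_writesNat _ _ _ _ _ (by simp [thresholdProg, Prog.WritesNat]),
          hR.nat10]
      have f1 : (thresholdProg.exec f opt ω τ₁).real 1 = s.real 1 := by
        rw [Prog.exec_real_of_not_writesArr _ _ _ _ _ (by simp [thresholdProg, Prog.WritesArr])]
        exact h2
      have f3 : (thresholdProg.exec f opt ω τ₁).real 3 = τ.real 3 := by
        rw [Prog.exec_real_of_not_writesArr _ _ _ _ _ (by simp [thresholdProg, Prog.WritesArr])]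
        rfl
      have c1 : τ₁.coins = s.coins + j * m := h4
      have t1 : τ₁.time = τ.time + 1 := rfl
      generalize thresholdProg.exec f opt ω τ₁ = τ₂ at *
      rw [c1] at g1 g2
      refine ⟨?_, ?_, ?_, ?_⟩
      · simp [Prog.exec, MState.tick, MState.setCell, MState.setArr, f1]
      · intro u hu
        by_cases huj : u = j
        · subst huj
          simp [Prog.exec, MState.tick, MState.setCell, MState.setArr, MState.readCell,
            RealOp.apply, f8, f10, f1, g1]
        · simp [Prog.exec, MState.tick, MState.setCell, MState.setArr, MState.readCell,
            RealOp.apply, f8, huj, f3, h3 u (by omega)]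
      · simp [Prog.exec, MState.tick, MState.setCell, MState.setArr, g2]; ring
      · simp [Prog.exec, MState.tick, MState.setCell, MState.setArr, g3, t1, h5]; ring)
  rw [h.nat0] at H
  exact ⟨H.2.2.1, H.2.2.2.1, H.2.2.2.2⟩

theorem marginalsProg_exec {k m : ℕ} {δ : ℝ} {s : MState} (h : Ready n k m δ s) :
    (∀ u : Fin n, (marginalsProg.exec f opt ω s).real 4 u
      = s.real 4 u + marginal f (Finset.univ.filter fun v => 0 < s.vec n 3 v) u) ∧
    (marginalsProg.exec f opt ω s).coins = s.coins ∧
    (marginalsProg.exec f opt ω s).time = s.time + (n + 2) + n * (n + 7) := by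
  set S : Finset (Fin n) := Finset.univ.filter fun v => 0 < s.vec n 3 v with hS
  have H := Prog.exec_forLoop_induction f opt ω
    (fun j τ => Ready n k m δ τ ∧ τ.real 3 = s.real 3 ∧ τ.real 9 0 = f S ∧
      (∀ u : Fin n, u < j → τ.real 4 u = s.real 4 u + marginal f S u) ∧
      (∀ u : Fin n, j ≤ u → τ.real 4 u = s.real 4 u) ∧
      τ.coins = s.coins ∧ τ.time = s.time + (n + 2) + j * (n + 7)) 8 0
    (.seq (.realArith .add ⟨11, 10⟩ ⟨3, 8⟩ ⟨12, 10⟩) <| .seq (.realOfNat ⟨3, 8⟩ 1) <|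
  .seq (.queryValue ⟨10, 10⟩ 3) <| .seq (.realArith .sub ⟨10, 10⟩ ⟨10, 10⟩ ⟨9, 10⟩) <|
  .seq (.realArith .add ⟨4, 8⟩ ⟨4, 8⟩ ⟨10, 10⟩) (.realArith .add ⟨3, 8⟩ ⟨11, 10⟩ ⟨12, 10⟩))
    ((Prog.queryValue ⟨9, 10⟩ 3).exec f opt ω s)
    ⟨(h.exec (.queryValue ⟨9, 10⟩ 3) (by simp [Prog.WritesNat])
      (by simp [Prog.WritesArr])).tick 1, by
        simp [Prog.exec, MState.tick, MState.setCell, MState.setArr], by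
        simp [Prog.exec, MState.tick, MState.setCell, MState.setArr, h.nat10, hS], by simp, by
        simp [Prog.exec, MState.tick, MState.setCell, MState.setArr], by
        simp [Prog.exec, MState.tick, MState.setCell, MState.setArr], by
        simp [Prog.exec, MState.tick, MState.setCell, MState.setArr]; ring⟩ (by
      rintro j hj τ ⟨h1, h2, h3, h4, h5, h6, h7⟩
      replace hj : j < n := hj.trans_eq h.nat0
      set τ₁ := (τ.setNat 8 j).tick 1 with hτ₁
      have hR : Ready n k m δ τ₁ := (h1.setNat 8 j (by simp)).tick 1
      refine ⟨hR.exec _ (by simp [Prog.WritesNat]) (by simp [Prog.WritesArr]), ?_⟩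
      have f8 : τ₁.nat 8 = j := by simp [hτ₁, MState.tick, MState.setNat]
      have i3 : τ₁.real 3 = s.real 3 := h2
      have i9 : τ₁.real 9 0 = f S := h3
      have i4 : τ₁.real 4 = τ.real 4 := rfl
      have ic : τ₁.coins = s.coins := h6
      have it : τ₁.time = τ.time + 1 := rfl
      -- Overwriting entry j of the sample by 1 adds exactly the element j to the sampled set.
      have hins : (Finset.univ.filter fun v : Fin n =>
          0 < Function.update (s.real 3) j 1 v) = insert ⟨j, hj⟩ S := by
        ext v
        by_cases hv : v = ⟨j, hj⟩
        · simp [hv]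
        · have : (v : ℕ) ≠ j := fun e => hv (Fin.ext e)
          rw [Finset.mem_filter, Finset.mem_insert, hS, Finset.mem_filter]
          simp [hv, this, MState.vec]
      clear_value τ₁
      have n1 := hR.nat1
      have n10 := hR.nat10
      have r12 := hR.real12
      refine ⟨?_, ?_, ?_, ?_, ?_, ?_⟩
      · simp [Prog.exec, MState.tick, MState.setCell, MState.setArr, MState.readCell,
          RealOp.apply, f8, i3, n10, r12]
      · simp [Prog.exec, MState.tick, MState.setCell, MState.setArr, i9]
      · intro u hu
        by_cases huj : (u : ℕ) = j
        · obtain rfl : u = ⟨j, hj⟩ := Fin.ext huj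
          simp [Prog.exec, MState.tick, MState.setCell, MState.setArr, MState.readCell,
            RealOp.apply, MState.vec, f8, i3, n10, n1, i9, i4, hins, marginal]
          exact h5 ⟨j, hj⟩ le_rfl
        · simp [Prog.exec, MState.tick, MState.setCell, MState.setArr, MState.readCell,
            RealOp.apply, f8, huj, i4, h4 u (by omega)]
      · intro u hu
        have huj : (u : ℕ) ≠ j := by omega
        simp [Prog.exec, MState.tick, MState.setCell, MState.setArr, MState.readCell,
            RealOp.apply, f8, huj, i4, h5 u (by omega)]
      · simp [Prog.exec, MState.tick, MState.setCell, MState.setArr, ic]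
      · simp [Prog.exec, MState.tick, MState.setCell, MState.setArr, it, h7]; ring)
  rw [show ((Prog.queryValue ⟨9, 10⟩ 3).exec f opt ω s).nat 0 = n from h.nat0] at H
  exact ⟨fun u => H.2.2.2.1 u u.2, H.2.2.2.2.2.1, H.2.2.2.2.2.2⟩

theorem estimateProg_exec {k m : ℕ} {δ : ℝ} {s : MState} (h : Ready n k m δ s) :
    (estimateProg.exec f opt ω s).vec n 4 = estimate f ω s.coins m m (s.vec n 1) ∧
    (estimateProg.exec f opt ω s).coins = s.coins + m * (n * m) ∧
    (estimateProg.exec f opt ω s).time = s.time + (2 + n * 2) +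
      m * (n + 4 + n * (4 + m * 4) + n * (n + 7)) := by
  set s₁ := (Prog.forLoop 8 0 (.realOfNat ⟨4, 8⟩ 10)).exec f opt ω s with hs₁
  have H₁ := Prog.exec_forLoop_induction f opt ω
    (fun j τ => (∀ u < j, τ.real 4 u = 0) ∧ τ.nat 10 = 0 ∧
      τ.coins = s.coins ∧ τ.time = s.time + 1 + j * 2) 8 0
    (.realOfNat ⟨4, 8⟩ 10) s
    ⟨by simp, h.nat10, rfl, rfl⟩ (by
      rintro j - τ ⟨h1, h2, h3, h4⟩
      refine ⟨fun u hu => ?_, ?_, ?_, ?_⟩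
      · by_cases huj : u = j
        · subst huj
          simp [Prog.exec, MState.tick, MState.setCell, MState.setArr, MState.setNat, h2]
        · simp [Prog.exec, MState.tick, MState.setCell, MState.setArr, MState.setNat, huj,
            h1 u (by omega)]
      · simp [Prog.exec, MState.tick, MState.setCell, MState.setArr, MState.setNat, h2]
      · simp [Prog.exec, MState.tick, MState.setCell, MState.setArr, MState.setNat, h3]
      · simp [Prog.exec, MState.tick, MState.setCell, MState.setArr, MState.setNat, h4]; ring)
  rw [h.nat0, ← hs₁] at H₁
  have hR₁ : Ready n k m δ s₁ := h.exec _ (by simp [Prog.WritesNat]) (by simp [Prog.WritesArr])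
  have hx₁ : s₁.real 1 = s.real 1 :=
    Prog.exec_real_of_not_writesArr _ _ _ _ _ (by simp [Prog.WritesArr]) _
  have H := Prog.exec_forLoop_induction f opt ω
    (fun j τ => Ready n k m δ τ ∧ τ.real 1 = s.real 1 ∧
      (∀ u : Fin n, τ.real 4 u = estimate f ω s.coins j m (s.vec n 1) u) ∧
      τ.coins = s.coins + j * (n * m) ∧ τ.time = s.time + (2 + n * 2) +
        j * (n + 4 + n * (4 + m * 4) + n * (n + 7))) 7 5
    (.seq sampleProg marginalsProg) s₁
    ⟨hR₁.tick 1, hx₁, fun u => by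
      rw [estimate, Finset.range_zero, Finset.sum_empty]; exact H₁.1 u u.2,
      by simpa [MState.tick] using H₁.2.2.1,
      by simp only [MState.tick, H₁.2.2.2]; ring⟩ (by
      rintro j - τ ⟨h1, h2, h3, h4, h5⟩
      set τ₁ := (τ.setNat 7 j).tick 1 with hτ₁
      have hR : Ready n k m δ τ₁ := (h1.setNat 7 j (by simp)).tick 1
      obtain ⟨g1, g2, g3⟩ := sampleProg_exec (f := f) (opt := opt) (ω := ω) hR
      have hR₂ : Ready n k m δ (sampleProg.exec f opt ω τ₁) := hR.exec _
        (by simp [thresholdProg, sampleProg, Prog.WritesNat])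
        (by simp [thresholdProg, sampleProg, Prog.WritesArr])
      have f1 : (sampleProg.exec f opt ω τ₁).real 1 = s.real 1 := by
        rw [Prog.exec_real_of_not_writesArr _ _ _ _ _
          (by simp [thresholdProg, sampleProg, Prog.WritesArr])]
        exact h2
      have f4 : (sampleProg.exec f opt ω τ₁).real 4 = τ.real 4 := by
        rw [Prog.exec_real_of_not_writesArr _ _ _ _ _
          (by simp [thresholdProg, sampleProg, Prog.WritesArr])]
        rfl
      have i1 : τ₁.real 1 = s.real 1 := h2
      have ic : τ₁.coins = s.coins + j * (n * m) := h4
      have it : τ₁.time = τ.time + 1 := rfl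
      rw [Prog.exec]
      generalize sampleProg.exec f opt ω τ₁ = τ₂ at *
      obtain ⟨e1, e2, e3⟩ := marginalsProg_exec (f := f) (opt := opt) (ω := ω) hR₂
      refine ⟨hR₂.exec _ (by simp [marginalsProg, Prog.WritesNat])
        (by simp [marginalsProg, Prog.WritesArr]), ?_, fun u => ?_, ?_, ?_⟩
      · rw [Prog.exec_real_of_not_writesArr _ _ _ _ _
          (by simp [marginalsProg, Prog.WritesArr]), f1]
      · have hS : (Finset.univ.filter fun v => 0 < τ₂.vec n 3 v)
            = sampleSet ω (s.coins + j * (n * m)) m (s.vec n 1) := by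
          ext v
          rw [sampleSet, Finset.mem_filter, Finset.mem_filter]
          simp [MState.vec, g1 v v.2, i1, ic]
        rw [e1, f4, h3, hS, estimate, estimate, Finset.sum_range_succ]
      · rw [e2, g2, ic]; ring
      · rw [e3, g3, it, h5]; ring)
  rw [hR₁.nat5] at H
  exact ⟨funext H.2.2.1, H.2.2.2.1, H.2.2.2.2⟩

theorem moveProg_exec {k m : ℕ} {δ : ℝ} {s : MState} (h : Ready n k m δ s) :
    (moveProg.exec f opt ω s).vec n 1 = s.vec n 1 + δ • opt (s.vec n 4) ∧
    (moveProg.exec f opt ω s).coins = s.coins ∧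
    (moveProg.exec f opt ω s).time = s.time + (n + 2) + n * 3 := by
  have H := Prog.exec_forLoop_induction f opt ω
    (fun j τ => Ready n k m δ τ ∧ (∀ u : Fin n, τ.real 5 u = opt (s.vec n 4) u) ∧
      (∀ u : Fin n, u < j → τ.real 1 u = s.real 1 u + δ * opt (s.vec n 4) u) ∧
      (∀ u : Fin n, j ≤ u → τ.real 1 u = s.real 1 u) ∧
      τ.coins = s.coins ∧ τ.time = s.time + (n + 2) + j * 3) 8 0
    (.seq (.realArith .mul ⟨10, 10⟩ ⟨2, 10⟩ ⟨5, 8⟩) (.realArith .add ⟨1, 8⟩ ⟨1, 8⟩ ⟨10, 10⟩))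
    ((Prog.queryOpt 5 4).exec f opt ω s)
    ⟨(h.exec (.queryOpt 5 4) (by simp [Prog.WritesNat])
      (by simp [Prog.WritesArr])).tick 1, by
        simp [Prog.exec, MState.tick, MState.setVec, MState.setArr], by simp, by
        simp [Prog.exec, MState.tick, MState.setVec, MState.setArr], by
        simp [Prog.exec, MState.tick, MState.setVec, MState.setArr], by
        simp [Prog.exec, MState.tick, MState.setVec, MState.setArr]; ring⟩ (by
      rintro j hj τ ⟨h1, h2, h3, h4, h5, h6⟩
      replace hj : j < n := hj.trans_eq h.nat0
      have n10 := h1.nat10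
      have r2 := h1.real2
      refine ⟨((h1.setNat 8 j (by simp)).tick 1).exec _ (by simp [Prog.WritesNat])
        (by simp [Prog.WritesArr]), ?_, fun u hu => ?_, fun u hu => ?_, ?_, ?_⟩
      · simp [Prog.exec, MState.tick, MState.setCell, MState.setArr, MState.setNat, h2]
      · by_cases huj : (u : ℕ) = j
        · obtain rfl : u = ⟨j, hj⟩ := Fin.ext huj
          have := h2 ⟨j, hj⟩
          have := h4 ⟨j, hj⟩ le_rfl
          simp_all [Prog.exec, MState.tick, MState.setCell, MState.setArr, MState.readCell,
            RealOp.apply, MState.setNat]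
        · simp [Prog.exec, MState.tick, MState.setCell, MState.setArr, MState.readCell,
            RealOp.apply, MState.setNat, huj, h3 u (by omega)]
      · have huj : (u : ℕ) ≠ j := by omega
        simp [Prog.exec, MState.tick, MState.setCell, MState.setArr, MState.readCell,
            RealOp.apply, MState.setNat, huj, h4 u (by omega)]
      · simp [Prog.exec, MState.tick, MState.setCell, MState.setArr, MState.setNat, h5]
      · simp [Prog.exec, MState.tick, MState.setCell, MState.setArr, MState.setNat, h6]; ring)
  rw [show ((Prog.queryOpt 5 4).exec f opt ω s).nat 0 = n from h.nat0] at H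
  exact ⟨funext fun u => H.2.2.1 u u.2, H.2.2.2.2.1, H.2.2.2.2.2⟩

theorem truncateProg_exec {k m : ℕ} {δ : ℝ} {s : MState} (h : Ready n k m δ s) :
    (truncateProg.exec f opt ω s).vec n 1 = s.vec n 1 ⊓ 1 ∧
    (truncateProg.exec f opt ω s).time = s.time + 1 + n * 4 := by
  have H := Prog.exec_forLoop_induction f opt ω
    (fun j τ => Ready n k m δ τ ∧
      (∀ u : Fin n, u < j → τ.real 1 u = min (s.real 1 u) 1) ∧
      (∀ u : Fin n, j ≤ u → τ.real 1 u = s.real 1 u) ∧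
      τ.time = s.time + 1 + j * 4) 8 0
    (.seq (.realOfNat ⟨10, 10⟩ 1)
    (.ifRealLE ⟨1, 8⟩ ⟨10, 10⟩ .skip (.realOfNat ⟨1, 8⟩ 1))) s
    ⟨h.tick 1, by simp, fun _ _ => rfl, rfl⟩ (by
      rintro j hj τ ⟨h1, h2, h3, h4⟩
      replace hj : j < n := hj.trans_eq h.nat0
      have n10 := h1.nat10
      have n1 := h1.nat1
      have h3j := h3 ⟨j, hj⟩ le_rfl
      refine ⟨((h1.setNat 8 j (by simp)).tick 1).exec _ (by simp [Prog.WritesNat])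
        (by simp [Prog.WritesArr]), ?_⟩
      by_cases hle : s.real 1 j ≤ 1
      · refine ⟨fun u hu => ?_, fun u hu => ?_, ?_⟩
        · by_cases huj : (u : ℕ) = j
          · obtain rfl : u = ⟨j, hj⟩ := Fin.ext huj
            simp_all [Prog.exec, MState.tick, MState.setCell, MState.setArr, MState.readCell,
              MState.setNat]
          · have := h2 u (by omega)
            simp_all [Prog.exec, MState.tick, MState.setCell, MState.setArr, MState.readCell,
              MState.setNat]
        · have := h3 u (by omega)
          simp_all [Prog.exec, MState.tick, MState.setCell, MState.setArr, MState.readCell,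
              MState.setNat]
        · simp_all [Prog.exec, MState.tick, MState.setCell, MState.setArr, MState.readCell,
              MState.setNat]
          ring
      · have hmin : min (s.real 1 j) 1 = 1 := min_eq_right (not_le.1 hle).le
        refine ⟨fun u hu => ?_, fun u hu => ?_, ?_⟩
        · by_cases huj : (u : ℕ) = j
          · obtain rfl : u = ⟨j, hj⟩ := Fin.ext huj
            simp [Prog.exec, MState.tick, MState.setCell, MState.setArr, MState.readCell,
              MState.setNat, n10, n1, h3j, hle, hmin]
          · simp [Prog.exec, MState.tick, MState.setCell, MState.setArr, MState.readCell,
              MState.setNat, n10, n1, h3j, hle, huj, h2 u (by omega)]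
        · have huj : (u : ℕ) ≠ j := by omega
          simp [Prog.exec, MState.tick, MState.setCell, MState.setArr, MState.readCell,
              MState.setNat, n10, n1, h3j, hle, huj, h3 u (by omega)]
        · simp [Prog.exec, MState.tick, MState.setCell, MState.setArr, MState.readCell,
              MState.setNat, n10, n1, h3j, hle, h4]
          ring)
  rw [h.nat0] at H
  exact ⟨funext fun u => H.2.1 u u.2, H.2.2.2⟩

/-- The time is an equality depending on n alone: loop lengths are functions of n, and the only
data-dependent branch is balanced. -/
theorem greedyProg_exec (c₀ c₁ : ℝ) :
    (greedyProg.exec f opt ω (MState.start n c₀ c₁)).vec n 1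
      = greedy f opt ω (c₁ / ((n + 1) ^ 2 : ℕ)) ((n + 1) ^ 8) ((n + 1) ^ 8) ((n + 1) ^ 2) ⊓ 1 ∧
    (greedyProg.exec f opt ω (MState.start n c₀ c₁)).time
      = 14 + 2 * (n + 1) + 2 * (n + 1) ^ 2 + 2 * (n + 1) ^ 4 + n * 4 + (n + 1) ^ 2 * (5 + n * 6 +
        (n + 1) ^ 8 * (n + 4 + n * (4 + (n + 1) ^ 8 * 4) + n * (n + 7))) := by
  obtain ⟨hR, hx, hc, ht⟩ := setupProg_exec (f := f) (opt := opt) (ω := ω) c₀ c₁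
  set s := setupProg.exec f opt ω (MState.start n c₀ c₁)
  set k := (n + 1) ^ 2
  set m := (n + 1) ^ 8
  set δ := c₁ / (k : ℕ)
  have H := Prog.exec_forLoop_induction f opt ω
    (fun i τ => Ready n k m δ τ ∧ τ.vec n 1 = greedy f opt ω δ m m i ∧
      τ.coins = i * (m * (n * m)) ∧ τ.time = s.time + 1 + i * (5 + n * 6 +
        m * (n + 4 + n * (4 + m * 4) + n * (n + 7)))) 6 3
    (.seq estimateProg moveProg) s
    ⟨hR.tick 1, by funext u; simp [MState.vec, MState.tick, hx, greedy],
      by simp [MState.tick, hc], by simp [MState.tick]⟩ (by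
      rintro i - τ ⟨h1, h2, h3, h4⟩
      set τ₁ := (τ.setNat 6 i).tick 1 with hτ₁
      have hR₁ : Ready n k m δ τ₁ := (h1.setNat 6 i (by simp)).tick 1
      obtain ⟨g1, g2, g3⟩ := estimateProg_exec (f := f) (opt := opt) (ω := ω) hR₁
      have hR₂ : Ready n k m δ (estimateProg.exec f opt ω τ₁) := hR₁.exec _
        (by simp [estimateProg, marginalsProg, thresholdProg, sampleProg, Prog.WritesNat])
        (by simp [estimateProg, marginalsProg, thresholdProg, sampleProg, Prog.WritesArr])
      have f1 : (estimateProg.exec f opt ω τ₁).vec n 1 = greedy f opt ω δ m m i := by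
        rw [← h2]
        funext u
        rw [MState.vec, Prog.exec_real_of_not_writesArr _ _ _ _ _
          (by simp [estimateProg, marginalsProg, thresholdProg, sampleProg, Prog.WritesArr])]
        rfl
      have i1 : τ₁.vec n 1 = greedy f opt ω δ m m i := h2
      have ic : τ₁.coins = i * (m * (n * m)) := h3
      have it : τ₁.time = τ.time + 1 := rfl
      rw [i1, ic] at g1
      rw [Prog.exec]
      generalize estimateProg.exec f opt ω τ₁ = τ₂ at *
      obtain ⟨e1, e2, e3⟩ := moveProg_exec (f := f) (opt := opt) (ω := ω) hR₂
      refine ⟨hR₂.exec _ (by simp [moveProg, Prog.WritesNat])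
        (by simp [moveProg, Prog.WritesArr]), ?_, ?_, ?_⟩
      · rw [e1, f1, g1, greedy]
      · rw [e2, g2, ic]; ring
      · rw [e3, g3, it, h4]; ring)
  rw [hR.nat3] at H
  obtain ⟨e1, e2⟩ := truncateProg_exec (f := f) (opt := opt) (ω := ω) H.1
  have e : greedyProg.exec f opt ω (MState.start n c₀ c₁) = truncateProg.exec f opt ω
    ((Prog.forLoop 6 3 (.seq estimateProg moveProg)).exec f opt ω s) := rfl
  rw [e, e1, e2, H.2.1, H.2.2.2, ht]
  exact ⟨rfl, by ring⟩

end ExecSpec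

/-! ## The multilinear extension as an expectation over product distributions -/

section Multilinear

variable {n : ℕ}

/-- The expectation of a function of the random set `{u | h u (ω u)}`, for independent `ω u`. -/
theorem sum_prod_mul_apply_filter {α : Type*} [Fintype α] (μ : Fin n → α → ℝ)
    (h : Fin n → α → Prop) [∀ u, DecidablePred (h u)] (φ : Finset (Fin n) → ℝ) :
    ∑ ω : Fin n → α, (∏ u, μ u (ω u)) * φ (Finset.univ.filter fun u => h u (ω u)) =
      ∑ S, φ S * ((∏ u ∈ S, ∑ a with h u a, μ u a) * ∏ u ∈ Sᶜ, ∑ a with ¬ h u a, μ u a) := by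
  -- Prescribing the random set to be S prescribes, separately for each u, whether `h u` holds; so
  -- the product of sums expands into a sum over the product space.
  have key : ∀ S : Finset (Fin n),
      ((∏ u ∈ S, ∑ a with h u a, μ u a) * ∏ u ∈ Sᶜ, ∑ a with ¬ h u a, μ u a) =
      ∑ ω : Fin n → α, if (Finset.univ.filter fun u => h u (ω u)) = S
        then ∏ u, μ u (ω u) else 0 := by
    intro S
    have h1 : ((∏ u ∈ S, ∑ a with h u a, μ u a) * ∏ u ∈ Sᶜ, ∑ a with ¬ h u a, μ u a) =
        ∏ u, ∑ a ∈ Finset.univ.filter (fun a => u ∈ S ↔ h u a), μ u a := by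
      rw [← Finset.prod_mul_prod_compl S]
      congr 1
      · refine Finset.prod_congr rfl fun u hu => ?_
        simp [hu]
      · refine Finset.prod_congr rfl fun u hu => ?_
        rw [Finset.mem_compl] at hu
        simp [hu]
    classical
    rw [h1, Finset.prod_univ_sum, ← Finset.sum_filter]
    refine Finset.sum_congr ?_ fun _ _ => rfl
    ext ω
    simp only [Fintype.mem_piFinset, Finset.mem_filter, Finset.mem_univ, true_and,
      Finset.ext_iff]
    exact forall_congr' fun _ => Iff.comm
  simp_rw [key, Finset.mul_sum]
  rw [Finset.sum_comm]
  refine Finset.sum_congr rfl fun ω _ => ?_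
  simp [mul_comm]

theorem multilinearExtension_eq_sum_pi {α : Type*} [Fintype α] (μ : Fin n → α → ℝ)
    (h : Fin n → α → Prop) [∀ u, DecidablePred (h u)] (hμ : ∀ u, ∑ a, μ u a = 1) (φ : Finset (Fin n) → ℝ) :
    multilinearExtension φ (fun u => ∑ a with h u a, μ u a) =
      ∑ ω : Fin n → α, (∏ u, μ u (ω u)) * φ (Finset.univ.filter fun u => h u (ω u)) := by
  rw [sum_prod_mul_apply_filter, multilinearExtension]
  refine Finset.sum_congr rfl fun S _ => ?_
  congr 2
  refine Finset.prod_congr rfl fun u _ => ?_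
  rw [← hμ u, ← Finset.sum_filter_add_sum_filter_not Finset.univ (fun a => h u a)]
  ring

theorem multilinearExtension_mono_left {φ ψ : Finset (Fin n) → ℝ} (h : ∀ S, φ S ≤ ψ S)
    {x : Fin n → ℝ} (h0 : 0 ≤ x) (h1 : x ≤ 1) :
    multilinearExtension φ x ≤ multilinearExtension ψ x := by
  refine Finset.sum_le_sum fun S _ => mul_le_mul_of_nonneg_right (h S) (mul_nonneg ?_ ?_)
  · exact Finset.prod_nonneg fun u _ => h0 u
  · exact Finset.prod_nonneg fun u _ => sub_nonneg.2 (h1 u)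

theorem multilinearExtension_add (φ ψ : Finset (Fin n) → ℝ) (x : Fin n → ℝ) :
    multilinearExtension (fun S => φ S + ψ S) x
      = multilinearExtension φ x + multilinearExtension ψ x := by
  simp [multilinearExtension, add_mul, Finset.sum_add_distrib]

theorem multilinearExtension_sub (φ ψ : Finset (Fin n) → ℝ) (x : Fin n → ℝ) :
    multilinearExtension (fun S => φ S - ψ S) x
      = multilinearExtension φ x - multilinearExtension ψ x := by
  simp [multilinearExtension, sub_mul, Finset.sum_sub_distrib]

theorem multilinearExtension_mul_const (φ : Finset (Fin n) → ℝ) (c : ℝ) (x : Fin n → ℝ) :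
    multilinearExtension (fun S => φ S * c) x = multilinearExtension φ x * c := by
  simp only [multilinearExtension, Finset.sum_mul]
  exact Finset.sum_congr rfl fun S _ => by ring

theorem multilinearExtension_sum {ι : Type*} (s : Finset ι) (φ : ι → Finset (Fin n) → ℝ)
    (x : Fin n → ℝ) :
    multilinearExtension (fun S => ∑ i ∈ s, φ i S) x = ∑ i ∈ s, multilinearExtension (φ i) x := by
  simp only [multilinearExtension, Finset.sum_mul]
  exact Finset.sum_comm

theorem multilinearExtension_const (c : ℝ) (x : Fin n → ℝ) :
    multilinearExtension (fun _ => c) x = c := by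
  have h := Finset.prod_add (fun u => x u) (fun u => 1 - x u) (Finset.univ : Finset (Fin n))
  simp only [add_sub_cancel, Finset.prod_const_one, Finset.powerset_univ] at h
  simp only [multilinearExtension, ← Finset.mul_sum, Finset.compl_eq_univ_sdiff]
  rw [← h, mul_one]

/-- Expand ∏_u (x_u + (1 - x_u)) with the second summand at v replaced by 0: the product becomes
x_v, and exactly the terms of sets avoiding v disappear. -/
theorem multilinearExtension_mem (v : Fin n) (x : Fin n → ℝ) :
    multilinearExtension (fun S => if v ∈ S then 1 else 0) x = x v := by
  have h := Finset.prod_add (fun u => x u) (fun u => if u = v then 0 else 1 - x u)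
    (Finset.univ : Finset (Fin n))
  rw [Finset.prod_eq_single v (by intro u _ hu; simp [hu]) (by simp)] at h
  simp only [if_true, add_zero, Finset.powerset_univ] at h
  rw [h, multilinearExtension]
  refine Finset.sum_congr rfl fun S _ => ?_
  rw [← Finset.compl_eq_univ_sdiff]
  by_cases hv : v ∈ S
  · simp only [hv, if_true, one_mul]
    congr 1
    refine Finset.prod_congr rfl fun u hu => ?_
    have : u ≠ v := by
      rintro rfl
      exact Finset.mem_compl.1 hu hv
    simp [this]
  · have h0 : ∏ u ∈ Sᶜ, (if u = v then 0 else 1 - x u) = 0 :=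
      Finset.prod_eq_zero (Finset.mem_compl.2 hv) (if_pos rfl)
    rw [h0, if_neg hv, mul_zero, zero_mul]

/-- The union of independent random sets with marginals `x` and `y` has marginals
`x + y - x * y`. -/
theorem multilinearExtension_union (φ : Finset (Fin n) → ℝ) (x y : Fin n → ℝ) :
    multilinearExtension φ (x + y - x * y) =
      multilinearExtension (fun S => multilinearExtension (fun D => φ (S ∪ D)) y) x := by
  set q : ℝ → Bool → ℝ := fun p b => if b then p else 1 - p with hq
  have e1 : ∀ (ψ : Finset (Fin n) → ℝ) (z : Fin n → ℝ), multilinearExtension ψ z =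
      ∑ b : Fin n → Bool, (∏ u, q (z u) (b u)) *
        ψ (Finset.univ.filter fun u => b u = true) := by
    intro ψ z
    rw [← multilinearExtension_eq_sum_pi (fun u b => q (z u) b) (fun _ b => b = true)]
    · congr 1
      funext u
      simp [hq, Finset.sum_filter]
    · intro u
      simp [hq]
  -- One pair of independent biased bits per element; the element is present if either bit is set.
  have e2 : multilinearExtension φ (x + y - x * y) =
      ∑ b : Fin n → Bool × Bool, (∏ u, q (x u) (b u).1 * q (y u) (b u).2) *
        φ (Finset.univ.filter fun u => ((b u).1 = true ∨ (b u).2 = true)) := by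
    rw [← multilinearExtension_eq_sum_pi (fun u (b : Bool × Bool) => q (x u) b.1 * q (y u) b.2)
      (fun _ b => b.1 = true ∨ b.2 = true)]
    · congr 1
      funext u
      simp [hq, Finset.sum_filter, Fintype.sum_prod_type]
      ring
    · intro u
      simp [hq, Fintype.sum_prod_type]
      ring
  rw [e2, e1, ← (Equiv.arrowProdEquivProdArrow (Fin n) (fun _ => Bool) (fun _ => Bool)).symm.sum_comp,
    Fintype.sum_prod_type]
  refine Finset.sum_congr rfl fun b _ => ?_
  rw [e1, Finset.mul_sum]
  refine Finset.sum_congr rfl fun c _ => ?_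
  change (∏ u, q (x u) (b u) * q (y u) (c u)) *
    φ (Finset.univ.filter fun u => (b u = true ∨ c u = true)) = _
  rw [Finset.prod_mul_distrib, Finset.filter_or]
  ring

/-- A coupling: R(x) is distributed as R(p) ∪ R(z) with independent parts. Take z = (x - p)/(1 - p),
and z = 0 where p = x = 1. -/
theorem exists_union_complement {p x : Fin n → ℝ} (h0 : 0 ≤ p) (hpx : p ≤ x) (h1 : x ≤ 1) :
    ∃ z : Fin n → ℝ, 0 ≤ z ∧ z ≤ 1 ∧ x = p + z - p * z := by
  have key : ∀ u, ∃ t : ℝ, 0 ≤ t ∧ t ≤ 1 ∧ x u = p u + t - p u * t := by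
    intro u
    have a0 := h0 u
    have a1 := hpx u
    have a2 := h1 u
    simp only [Pi.zero_apply, Pi.one_apply] at a0 a2
    rcases eq_or_lt_of_le (a1.trans a2) with h | h
    · exact ⟨0, le_rfl, zero_le_one, by linarith⟩
    · refine ⟨(x u - p u) / (1 - p u), div_nonneg (by linarith) (by linarith),
        (div_le_one (by linarith)).2 (by linarith), ?_⟩
      have : 1 - p u ≠ 0 := by linarith
      field_simp
      ring
  choose z hz using key
  exact ⟨z, fun u => (hz u).1, fun u => (hz u).2.1, funext fun u => (hz u).2.2⟩

theorem multilinearExtension_mono_right {f : Finset (Fin n) → ℝ} (hf : Monotone f)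
    {p x : Fin n → ℝ} (h0 : 0 ≤ p) (hpx : p ≤ x) (h1 : x ≤ 1) :
    multilinearExtension f p ≤ multilinearExtension f x := by
  obtain ⟨z, hz0, hz1, rfl⟩ := exists_union_complement h0 hpx h1
  rw [multilinearExtension_union]
  refine multilinearExtension_mono_left (fun S => ?_) h0 (hpx.trans h1)
  refine le_trans (multilinearExtension_const (f S) z).ge ?_
  exact multilinearExtension_mono_left (fun D => hf Finset.subset_union_left) hz0 hz1

theorem multilinearExtension_zero (f : Finset (Fin n) → ℝ) : multilinearExtension f 0 = f ∅ := by
  rw [multilinearExtension, Finset.sum_eq_single ∅]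
  · simp
  · intro S _ hS
    obtain ⟨u, hu⟩ := Finset.nonempty_iff_ne_empty.2 hS
    rw [Finset.prod_eq_zero hu (by simp)]
    simp
  · simp

end Multilinear

/-! ## Marginals of monotone submodular functions -/

section Submodular

variable {n : ℕ} {f : Finset (Fin n) → ℝ}

theorem marginal_nonneg (hf : Monotone f) (S : Finset (Fin n)) (u : Fin n) :
    0 ≤ marginal f S u := sub_nonneg.2 (hf (Finset.subset_insert u S))

theorem IsSubmodular.marginal_anti (hs : IsSubmodular f) (hf : Monotone f)
    {S R : Finset (Fin n)} (h : S ⊆ R) (u : Fin n) : marginal f R u ≤ marginal f S u := by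
  by_cases hu : u ∈ R
  · refine le_trans (le_of_eq ?_) (marginal_nonneg hf S u)
    rw [marginal, Finset.insert_eq_of_mem hu, sub_self]
  · have h1 := hs (insert u S) R
    rw [Finset.insert_union, Finset.union_eq_right.2 h, Finset.insert_inter_of_notMem hu,
      Finset.inter_eq_left.2 h] at h1
    simp only [marginal]
    linarith

/-- Add the elements of O to S one by one; each marginal is at most the one with respect to S. -/
theorem IsSubmodular.le_add_sum_marginal (hs : IsSubmodular f) (hf : Monotone f)
    (O S : Finset (Fin n)) : f O ≤ f S + ∑ u ∈ O, marginal f S u := by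
  suffices h : f (S ∪ O) ≤ f S + ∑ u ∈ O, marginal f S u from
    (hf Finset.subset_union_right).trans h
  induction O using Finset.induction_on with
  | empty => simp
  | insert u O hu ih =>
    rw [Finset.sum_insert hu, Finset.union_insert]
    have := hs.marginal_anti hf (Finset.subset_union_left : S ⊆ S ∪ O) u
    rw [marginal] at this
    linarith

/-- The expected marginal of `u` with respect to a random set with marginals `x`. -/
def expectedMarginal (f : Finset (Fin n) → ℝ) (x : Fin n → ℝ) (u : Fin n) : ℝ :=
  multilinearExtension (fun S => marginal f S u) x

theorem expectedMarginal_zero (f : Finset (Fin n) → ℝ) (u : Fin n) :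
    expectedMarginal f 0 u = marginal f ∅ u := multilinearExtension_zero _

theorem IsSubmodular.le_add_sum_expectedMarginal (hs : IsSubmodular f) (hf : Monotone f)
    (O : Finset (Fin n)) {x : Fin n → ℝ} (h0 : 0 ≤ x) (h1 : x ≤ 1) :
    f O ≤ multilinearExtension f x + ∑ u ∈ O, expectedMarginal f x u := by
  simp only [expectedMarginal]
  rw [← multilinearExtension_sum, ← multilinearExtension_add]
  exact (multilinearExtension_const (f O) x).ge.trans
    (multilinearExtension_mono_left (fun S => hs.le_add_sum_marginal hf O S) h0 h1)

/-- Couple R(x) = R(p) ∪ D with D = R(z). The marginal can drop only if D contains some v outside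
R(p), and then by at most f(u | ∅). The event for v has probability (1 - p_v)z_v = x_v - p_v, and a
union bound finishes. This controls the rounding of the sampling probabilities. -/
theorem IsSubmodular.expectedMarginal_le (hs : IsSubmodular f) (hf : Monotone f)
    {p x : Fin n → ℝ} (h0 : 0 ≤ p) (hpx : p ≤ x) (h1 : x ≤ 1) (u : Fin n) :
    expectedMarginal f p u ≤ expectedMarginal f x u + (∑ v, (x v - p v)) * marginal f ∅ u := by
  obtain ⟨z, hz0, hz1, rfl⟩ := exists_union_complement h0 hpx h1
  set g := marginal f ∅ u
  have hg : 0 ≤ g := marginal_nonneg hf ∅ u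
  have key : ∀ S D : Finset (Fin n), marginal f S u ≤ marginal f (S ∪ D) u +
      ∑ v, (if v ∈ D then 1 else 0) * ((1 - if v ∈ S then 1 else 0) * g) := by
    intro S D
    have hnn : ∀ v ∈ Finset.univ, 0 ≤ (if v ∈ D then (1 : ℝ) else 0) *
        ((1 - if v ∈ S then 1 else 0) * g) := by
      intro v _
      split_ifs <;> simp [hg]
    by_cases hDS : D ⊆ S
    · rw [Finset.union_eq_left.2 hDS]
      exact le_add_of_nonneg_right (Finset.sum_nonneg hnn)
    · obtain ⟨v, hvD, hvS⟩ := Finset.not_subset.1 hDS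
      have h2 := Finset.single_le_sum hnn (Finset.mem_univ v)
      simp only [hvD, hvS, if_true, if_false, sub_zero, one_mul] at h2
      have h3 := hs.marginal_anti hf (Finset.empty_subset S) u
      have h4 := marginal_nonneg hf (S ∪ D) u
      linarith
  have hD : ∀ S : Finset (Fin n), marginal f S u ≤
      multilinearExtension (fun D => marginal f (S ∪ D) u) z +
        ∑ v, (1 - if v ∈ S then 1 else 0) * (z v * g) := by
    intro S
    refine (multilinearExtension_const (marginal f S u) z).ge.trans
      ((multilinearExtension_mono_left (key S) hz0 hz1).trans (le_of_eq ?_))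
    rw [multilinearExtension_add, multilinearExtension_sum]
    simp only [multilinearExtension_mul_const, multilinearExtension_mem]
    congr 1
    exact Finset.sum_congr rfl fun v _ => by ring
  refine (multilinearExtension_mono_left hD h0 (hpx.trans h1)).trans (le_of_eq ?_)
  rw [multilinearExtension_add, multilinearExtension_sum, expectedMarginal,
    multilinearExtension_union]
  simp only [multilinearExtension_mul_const, multilinearExtension_sub, multilinearExtension_const,
    multilinearExtension_mem, Finset.sum_mul]
  congr 1
  refine Finset.sum_congr rfl fun v _ => ?_
  simp only [Pi.add_apply, Pi.sub_apply, Pi.mul_apply]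
  ring

theorem one_sub_sum_le_prod_one_sub {ι : Type*} (s : Finset ι) (z : ι → ℝ)
    (h0 : ∀ i ∈ s, 0 ≤ z i) (h1 : ∀ i ∈ s, z i ≤ 1) :
    1 - ∑ i ∈ s, z i ≤ ∏ i ∈ s, (1 - z i) := by
  classical
  induction s using Finset.induction_on with
  | empty => simp
  | insert a s ha ih =>
    rw [Finset.sum_insert ha, Finset.prod_insert ha]
    have h2 := ih (fun i hi => h0 i (Finset.mem_insert_of_mem hi))
      (fun i hi => h1 i (Finset.mem_insert_of_mem hi))
    have h3 := h0 a (Finset.mem_insert_self a s)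
    have h4 := h1 a (Finset.mem_insert_self a s)
    have h5 : ∏ i ∈ s, (1 - z i) ≤ 1 := Finset.prod_le_one
      (fun i hi => sub_nonneg.2 (h1 i (Finset.mem_insert_of_mem hi)))
      (fun i hi => sub_le_self _ (h0 i (Finset.mem_insert_of_mem hi)))
    nlinarith

/-- The gain of a small step of continuous greedy. -/
theorem le_multilinearExtension_step (hf : Monotone f) {x y : Fin n → ℝ} {δ : ℝ}
    (hx0 : 0 ≤ x) (hx1 : x ≤ 1) (hy0 : 0 ≤ y) (hy1 : y ≤ 1) (hδ0 : 0 ≤ δ) (hδ1 : δ ≤ 1) :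
    multilinearExtension f x + δ * (1 - δ * n) * ∑ u, y u * expectedMarginal f x u ≤
      multilinearExtension f ((x + δ • y) ⊓ 1) := by
  set z : Fin n → ℝ := δ • y with hz
  have hz0 : 0 ≤ z := fun u => mul_nonneg hδ0 (hy0 u)
  have hzδ : ∀ u, z u ≤ δ := fun u => mul_le_of_le_one_right hδ0 (hy1 u)
  have hz1 : z ≤ 1 := fun u => (hzδ u).trans hδ1
  -- By monotonicity the truncated sum may be replaced by the probabilities of the union R(x) ∪
  -- R(z).
  have hle : x + z - x * z ≤ (x + z) ⊓ 1 := by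
    intro u
    have a0 := hx0 u
    have a1 := hx1 u
    have b0 := hz0 u
    have b1 := hz1 u
    simp only [Pi.zero_apply, Pi.one_apply] at a0 a1 b0 b1
    simp only [Pi.inf_apply, Pi.add_apply, Pi.sub_apply, Pi.mul_apply, Pi.one_apply, le_inf_iff]
    constructor <;> nlinarith
  have hnn : 0 ≤ x + z - x * z := by
    intro u
    have a0 := hx0 u
    have a1 := hx1 u
    have b0 := hz0 u
    simp only [Pi.zero_apply, Pi.one_apply] at a0 a1 b0
    simp only [Pi.zero_apply, Pi.add_apply, Pi.sub_apply, Pi.mul_apply]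
    nlinarith
  refine le_trans ?_ (multilinearExtension_mono_right hf hnn hle inf_le_right)
  rw [multilinearExtension_union]
  -- A lower bound for the probability that R(z) = {u}.
  have hsingle : ∀ u, δ * (1 - δ * n) * y u ≤ (∏ v ∈ {u}, z v) * ∏ v ∈ {u}ᶜ, (1 - z v) := by
    intro u
    rw [Finset.prod_singleton]
    have h1 := one_sub_sum_le_prod_one_sub ({u}ᶜ : Finset (Fin n)) z (fun i _ => hz0 i)
      (fun i _ => hz1 i)
    have h2 : ∑ v ∈ ({u}ᶜ : Finset (Fin n)), z v ≤ δ * n :=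
      (Finset.sum_le_sum_of_subset_of_nonneg (Finset.subset_univ _) (fun i _ _ => hz0 i)).trans
        ((Finset.sum_le_sum fun i _ => hzδ i).trans (by simp [mul_comm]))
    calc δ * (1 - δ * n) * y u = z u * (1 - δ * n) := by simp [hz]; ring
      _ ≤ _ := mul_le_mul_of_nonneg_left (by linarith) (hz0 u)
  have key : ∀ S : Finset (Fin n), f S + ∑ u, marginal f S u * (δ * (1 - δ * n) * y u) ≤
      multilinearExtension (fun D => f (S ∪ D)) z := by
    intro S
    -- Only the gain from singletons D is kept; for every other D monotonicity gives a gain of at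
    -- least 0.
    have h1 : ∀ D : Finset (Fin n), f S + ∑ u, (if D = {u} then 1 else 0) * marginal f S u ≤
        f (S ∪ D) := by
      intro D
      by_cases hD : ∃ v, D = {v}
      · obtain ⟨v, rfl⟩ := hD
        simp only [Finset.singleton_inj, ite_mul, one_mul, zero_mul, Finset.sum_ite_eq,
          Finset.mem_univ, if_true, marginal, Finset.union_singleton]
        linarith
      · push Not at hD
        simp only [hD, if_false, zero_mul, Finset.sum_const_zero, add_zero]
        exact hf Finset.subset_union_left
    refine le_trans ?_ (multilinearExtension_mono_left h1 hz0 hz1)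
    rw [multilinearExtension_add, multilinearExtension_const, multilinearExtension_sum]
    simp only [multilinearExtension_mul_const]
    refine add_le_add_right (Finset.sum_le_sum fun u _ => ?_) _
    rw [mul_comm]
    refine mul_le_mul_of_nonneg_right ((hsingle u).trans (le_of_eq ?_)) (marginal_nonneg hf S u)
    simp [multilinearExtension]
  refine le_trans (le_of_eq ?_) (multilinearExtension_mono_left key hx0 hx1)
  rw [multilinearExtension_add, multilinearExtension_sum, Finset.mul_sum]
  simp only [multilinearExtension_mul_const, expectedMarginal]
  congr 1
  exact Finset.sum_congr rfl fun u _ => by ring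

end Submodular

/-! ## Expectations over coin tosses -/

section Coins

/-- The expectation over `t` fair coins. -/
noncomputable def coinExpect (t : ℕ) (g : (ℕ → Bool) → ℝ) : ℝ :=
  𝔼 ω : Fin t → Bool, g (extendCoins ω)

/-- The first `a` coins of `ω`, followed by `ω'`. -/
def glueCoins (a : ℕ) (ω ω' : ℕ → Bool) : ℕ → Bool :=
  fun i => if i < a then ω i else ω' (i - a)

theorem glueCoins_of_lt {a i : ℕ} (h : i < a) (ω ω' : ℕ → Bool) : glueCoins a ω ω' i = ω i :=
  if_pos h

theorem glueCoins_add (a i : ℕ) (ω ω' : ℕ → Bool) : glueCoins a ω ω' (a + i) = ω' i := by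
  simp [glueCoins]

theorem coinExpect_mono {t : ℕ} {g h : (ℕ → Bool) → ℝ} (H : ∀ ω, g ω ≤ h ω) :
    coinExpect t g ≤ coinExpect t h := Finset.expect_le_expect fun _ _ => H _

theorem coinExpect_const (t : ℕ) (c : ℝ) : coinExpect t (fun _ => c) = c := Fintype.expect_const c

theorem coinExpect_add (t : ℕ) (g h : (ℕ → Bool) → ℝ) :
    coinExpect t (fun ω => g ω + h ω) = coinExpect t g + coinExpect t h :=
  Finset.expect_add_distrib _ _ _

theorem coinExpect_sub (t : ℕ) (g h : (ℕ → Bool) → ℝ) :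
    coinExpect t (fun ω => g ω - h ω) = coinExpect t g - coinExpect t h :=
  Finset.expect_sub_distrib _ _ _

theorem coinExpect_const_mul (t : ℕ) (c : ℝ) (g : (ℕ → Bool) → ℝ) :
    coinExpect t (fun ω => c * g ω) = c * coinExpect t g := (Finset.mul_expect _ _ _).symm

theorem coinExpect_sum {ι : Type*} (s : Finset ι) (t : ℕ) (g : ι → (ℕ → Bool) → ℝ) :
    coinExpect t (fun ω => ∑ i ∈ s, g i ω) = ∑ i ∈ s, coinExpect t (g i) :=
  Finset.expect_sum_comm _ _ _

/-- Fubini for coins; it serves as conditioning on the first a coins. -/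
theorem coinExpect_split (a b : ℕ) (g : (ℕ → Bool) → ℝ) :
    coinExpect (a + b) g =
      coinExpect a fun ω => coinExpect b fun ω' => g (glueCoins a ω ω') := by
  simp only [coinExpect]
  rw [← Finset.expect_product', Finset.univ_product_univ]
  refine (Fintype.expect_equiv (Fin.appendEquiv a b) _ _ ?_).symm
  rintro ⟨v, w⟩
  congr 1
  funext i
  simp only [glueCoins, extendCoins, Fin.appendEquiv, Equiv.coe_fn_mk]
  by_cases h1 : i < a
  · rw [if_pos h1, dif_pos h1, dif_pos (show i < a + b by omega)]
    exact (Fin.append_left v w ⟨i, h1⟩).symm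
  · by_cases h2 : i < a + b
    · have : (⟨i, h2⟩ : Fin (a + b)) = Fin.natAdd a ⟨i - a, by omega⟩ := by
        ext
        simp only [Fin.natAdd_mk]
        omega
      rw [if_neg h1, dif_pos (show i - a < b by omega), dif_pos h2, this, Fin.append_right]
    · simp [h1, h2, show ¬ i - a < b by omega]

/-- Unread coins do not affect an expectation. This passes from the coins actually used to the
larger number allotted by the time bound. -/
theorem coinExpect_eq_of_le {a t : ℕ} (h : a ≤ t) (g : (ℕ → Bool) → ℝ)
    (hg : ∀ ω ω', (∀ i < a, ω i = ω' i) → g ω = g ω') : coinExpect t g = coinExpect a g := by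
  obtain ⟨b, rfl⟩ := Nat.exists_eq_add_of_le h
  rw [coinExpect_split]
  congr 1
  funext ω
  rw [show (fun ω' => g (glueCoins a ω ω')) = fun _ => g ω from
    funext fun ω' => hg _ _ fun i hi => glueCoins_of_lt hi ω ω', coinExpect_const]

theorem coinExpect_one (g : (ℕ → Bool) → ℝ) (h : Bool → ℝ) (hg : ∀ ω, g ω = h (ω 0)) :
    coinExpect 1 g = (h true + h false) / 2 := by
  simp only [coinExpect, hg]
  rw [Fintype.expect_equiv (Equiv.funUnique (Fin 1) Bool) _ h (fun ω => by simp [extendCoins])]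
  rw [Fintype.expect_eq_sum_div_card]
  simp

/-- Cauchy–Schwarz against the constant 1. -/
theorem coinExpect_abs_le {t : ℕ} {g : (ℕ → Bool) → ℝ} {c : ℝ} (hc : 0 ≤ c)
    (h : coinExpect t (fun ω => g ω ^ 2) ≤ c ^ 2) : coinExpect t (fun ω => |g ω|) ≤ c := by
  have h1 := Finset.expect_mul_sq_le_sq_mul_sq (Finset.univ : Finset (Fin t → Bool))
    (fun ω => |g (extendCoins ω)|) (fun _ => 1)
  simp only [mul_one, one_pow, sq_abs, Fintype.expect_const] at h1
  exact le_of_sq_le_sq (h1.trans h) hc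

/-- The variance of a sum over independent blocks of coins. -/
theorem coinExpect_sq_sum (D m : ℕ) (h : (ℕ → Bool) → ℝ)
    (hh : ∀ ω ω', (∀ i < D, ω i = ω' i) → h ω = h ω') (h0 : coinExpect D h = 0) :
    coinExpect (m * D) (fun ω => (∑ j ∈ Finset.range m, h fun i => ω (j * D + i)) ^ 2) =
      m * coinExpect D fun ω => h ω ^ 2 := by
  induction m with
  | zero => simp [coinExpect_const]
  | succ m ih =>
    rw [show (m + 1) * D = m * D + D by ring, coinExpect_split]
    have e : ∀ ω ω' : ℕ → Bool, (∑ j ∈ Finset.range (m + 1),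
        h fun i => glueCoins (m * D) ω ω' (j * D + i)) =
        (∑ j ∈ Finset.range m, h fun i => ω (j * D + i)) + h ω' := by
      intro ω ω'
      rw [Finset.sum_range_succ]
      congr 1
      · refine Finset.sum_congr rfl fun j hj => hh _ _ fun i hi => glueCoins_of_lt ?_ _ _
        have := Finset.mem_range.1 hj
        nlinarith
      · exact hh _ _ fun i _ => glueCoins_add _ _ _ _
    simp only [e]
    -- The cross term vanishes because the new block has mean zero.
    have e2 : ∀ s : ℝ, coinExpect D (fun ω' => (s + h ω') ^ 2) =
        s ^ 2 + coinExpect D fun ω' => h ω' ^ 2 := by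
      intro s
      simp only [add_sq, coinExpect_add, coinExpect_const, coinExpect_const_mul, h0]
      ring
    simp only [e2, coinExpect_add, ih, coinExpect_const]
    push_cast
    ring

end Coins

/-! ## Random thresholds and random sets -/

section Sampling

variable {n : ℕ}

theorem dyadic_congr {ω ω' : ℕ → Bool} {c c' b : ℕ} (h : ∀ i < b, ω (c + i) = ω' (c' + i)) :
    dyadic ω c b = dyadic ω' c' b := by
  induction b with
  | zero => rfl
  | succ b ih => rw [dyadic, dyadic, ih fun i hi => h i (by omega), h b (by omega)]

theorem dyadic_pos (ω : ℕ → Bool) (c b : ℕ) : 0 < dyadic ω c b := by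
  induction b with
  | zero => simp [dyadic]
  | succ b ih =>
    rw [dyadic]
    split_ifs <;> linarith

theorem sampleSet_congr {ω ω' : ℕ → Bool} {c c' l : ℕ} (x : Fin n → ℝ)
    (h : ∀ i < n * l, ω (c + i) = ω' (c' + i)) : sampleSet ω c l x = sampleSet ω' c' l x := by
  refine Finset.filter_congr fun u _ => ?_
  rw [dyadic_congr (ω' := ω') (c' := c' + u * l)]
  intro i hi
  have h1 : (u : ℕ) * l + i < n * l := by nlinarith [u.2]
  simpa only [add_assoc] using h _ h1

theorem estimate_congr (f : Finset (Fin n) → ℝ) {ω ω' : ℕ → Bool} {c c' m l : ℕ} (x : Fin n → ℝ)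
    (h : ∀ i < m * (n * l), ω (c + i) = ω' (c' + i)) :
    estimate f ω c m l x = estimate f ω' c' m l x := by
  funext u
  refine Finset.sum_congr rfl fun j hj => ?_
  rw [sampleSet_congr (ω' := ω') (c' := c' + j * (n * l))]
  intro i hi
  have := Finset.mem_range.1 hj
  have h1 : j * (n * l) + i < m * (n * l) := by nlinarith
  simpa only [add_assoc] using h _ h1

theorem sampleSet_zero (ω : ℕ → Bool) (c l : ℕ) : sampleSet ω c l (0 : Fin n → ℝ) = ∅ :=
  Finset.filter_eq_empty_iff.2 fun _ _ => not_lt.2 (dyadic_pos _ _ _).le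

theorem estimate_zero (f : Finset (Fin n) → ℝ) (ω : ℕ → Bool) (c m l : ℕ) :
    estimate f ω c m l 0 = (m : ℝ) • marginal f ∅ := by
  funext u
  simp [estimate, sampleSet_zero]

/-- The probability that a random threshold is less than `t`. -/
noncomputable def thresholdProb (l : ℕ) (t : ℝ) : ℝ :=
  coinExpect l fun ω => if dyadic ω 0 l < t then 1 else 0

/-- The last coin is the leading binary digit: (d + b)/2 < t means d < 2t - b. -/
theorem thresholdProb_succ (l : ℕ) (t : ℝ) :
    thresholdProb (l + 1) t = (thresholdProb l (2 * t - 1) + thresholdProb l (2 * t)) / 2 := by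
  have h1 : ∀ ω : ℕ → Bool, coinExpect 1 (fun ω' =>
      if dyadic (glueCoins l ω ω') 0 (l + 1) < t then (1 : ℝ) else 0) =
      1 / 2 * ((if dyadic ω 0 l < 2 * t - 1 then (1 : ℝ) else 0) +
        if dyadic ω 0 l < 2 * t then (1 : ℝ) else 0) := by
    intro ω
    rw [coinExpect_one _ (fun b => if (dyadic ω 0 l + if b then 1 else 0) / 2 < t then 1 else 0)]
    · have e1 : (dyadic ω 0 l + 1) / 2 < t ↔ dyadic ω 0 l < 2 * t - 1 := by
        constructor <;> intro h <;> linarith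
      have e2 : (dyadic ω 0 l + 0) / 2 < t ↔ dyadic ω 0 l < 2 * t := by
        constructor <;> intro h <;> linarith
      simp only [if_true, Bool.false_eq_true, if_false, e1, e2]
      ring
    · intro ω'
      have e1 : glueCoins l ω ω' (0 + l) = ω' 0 := by
        rw [zero_add]; exact glueCoins_add l 0 ω ω'
      rw [dyadic, e1, dyadic_congr (ω' := ω) (c' := 0)]
      intro i hi
      exact glueCoins_of_lt (by omega) _ _
  rw [thresholdProb, coinExpect_split]
  simp only [h1, coinExpect_const_mul, coinExpect_add]
  simp only [thresholdProb]
  ring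

/-- In the recursion one of the two terms is always exactly 0 or 1, so the error halves with each
coin. The case t = 1 belongs to the approximate range, since a threshold can equal 1. -/
theorem thresholdProb_bounds (l : ℕ) (t : ℝ) : (t ≤ 0 → thresholdProb l t = 0) ∧
    (1 < t → thresholdProb l t = 1) ∧
    (0 < t → t ≤ 1 → t - (1 / 2) ^ l ≤ thresholdProb l t ∧ thresholdProb l t ≤ t) := by
  induction l generalizing t with
  | zero =>
    have e : thresholdProb 0 t = if 1 < t then 1 else 0 := by
      simp only [thresholdProb, dyadic]
      exact coinExpect_const _ _
    rw [e]
    refine ⟨fun h => if_neg (by linarith), fun h => if_pos h, fun h h' => ?_⟩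
    rw [if_neg (by linarith)]
    constructor <;> norm_num <;> linarith
  | succ l ih =>
    obtain ⟨a1, a2, a3⟩ := ih (2 * t - 1)
    obtain ⟨b1, b2, b3⟩ := ih (2 * t)
    rw [thresholdProb_succ, pow_succ]
    refine ⟨fun h => ?_, fun h => ?_, fun h h' => ?_⟩
    · rw [a1 (by linarith), b1 (by linarith)]; norm_num
    · rw [a2 (by linarith), b2 (by linarith)]; norm_num
    · rcases le_or_gt (2 * t) 1 with h2 | h2
      · obtain ⟨b4, b5⟩ := b3 (by linarith) h2
        rw [a1 (by linarith)]
        constructor <;> linarith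
      · obtain ⟨a4, a5⟩ := a3 (by linarith) (by linarith)
        rw [b2 h2]
        constructor <;> linarith

theorem thresholdProb_nonneg (l : ℕ) (t : ℝ) : 0 ≤ thresholdProb l t :=
  (coinExpect_const l 0).ge.trans (coinExpect_mono fun ω => by split_ifs <;> norm_num)

theorem thresholdProb_le {l : ℕ} {t : ℝ} (ht : 0 ≤ t) : thresholdProb l t ≤ min t 1 := by
  obtain ⟨h1, h2, h3⟩ := thresholdProb_bounds l t
  rcases ht.eq_or_lt with h | h
  · rw [h1 h.ge]; exact le_min ht zero_le_one
  · rcases le_or_gt t 1 with h' | h'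
    · rw [min_eq_left h']; exact (h3 h h').2
    · rw [min_eq_right h'.le, h2 h']

theorem le_thresholdProb {l : ℕ} {t : ℝ} (ht : 0 ≤ t) :
    min t 1 - thresholdProb l t ≤ (1 / 2) ^ l := by
  obtain ⟨h1, h2, h3⟩ := thresholdProb_bounds l t
  have h4 : (0 : ℝ) < (1 / 2) ^ l := by positivity
  rcases ht.eq_or_lt with h | h
  · rw [h1 h.ge, ← h]; simp
  · rcases le_or_gt t 1 with h' | h'
    · rw [min_eq_left h']; linarith [(h3 h h').1]
    · rw [min_eq_right h'.le, h2 h']; linarith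

/-- The n·l coins split into n independent uniform blocks of length l, one per element. -/
theorem coinExpect_sampleSet (l : ℕ) (x : Fin n → ℝ) (φ : Finset (Fin n) → ℝ) :
    coinExpect (n * l) (fun ω => φ (sampleSet ω 0 l x)) =
      multilinearExtension φ fun u => thresholdProb l (x u) := by
  classical
  have hcard : (Fintype.card (Fin l → Bool) : ℝ) ≠ 0 := by simp
  have h1 : (fun u => thresholdProb l (x u)) = fun u => ∑ b : Fin l → Bool with
      dyadic (extendCoins b) 0 l < x u, (Fintype.card (Fin l → Bool) : ℝ)⁻¹ := by
    funext u
    rw [thresholdProb, coinExpect, Fintype.expect_eq_sum_div_card, Finset.sum_filter,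
      Finset.sum_div]
    refine Finset.sum_congr rfl fun b _ => ?_
    split_ifs <;> simp
  rw [h1, multilinearExtension_eq_sum_pi
    (fun _ _ => (Fintype.card (Fin l → Bool) : ℝ)⁻¹)
    (fun u b => dyadic (extendCoins b) 0 l < x u) (by intro u; simp)]
  rw [coinExpect, Fintype.expect_equiv
    ((Equiv.arrowCongr finProdFinEquiv.symm (Equiv.refl Bool)).trans
      (Equiv.curry (Fin n) (Fin l) Bool)) _
    (fun ω => φ (Finset.univ.filter fun u => dyadic (extendCoins (ω u)) 0 l < x u))]
  · rw [Fintype.expect_eq_sum_div_card, Finset.sum_div]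
    refine Finset.sum_congr rfl fun ω _ => ?_
    simp
    ring
  · intro ω
    congr 1
    refine Finset.filter_congr fun u _ => ?_
    rw [dyadic_congr (ω' := extendCoins _) (c' := 0)]
    intro i hi
    have h2 : (u : ℕ) * l + i < n * l := by nlinarith [u.2]
    simp only [extendCoins, zero_add, hi, h2, dif_pos]
    simp only [Equiv.trans_apply, Equiv.curry_apply, Function.curry, Equiv.arrowCongr_apply,
      Function.comp, Equiv.symm_symm, Equiv.refl_apply]
    congr 1
    ext
    simp [finProdFinEquiv]
    ring

/-- The error of the sampled weights. -/
theorem coinExpect_abs_estimate_sub_le {f : Finset (Fin n) → ℝ} (hs : IsSubmodular f)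
    (hf : Monotone f) (q l : ℕ) {x : Fin n → ℝ} (hx : 0 ≤ x) (u : Fin n) :
    coinExpect (q ^ 2 * (n * l)) (fun ω => |estimate f ω 0 (q ^ 2) l x u -
      (q ^ 2 : ℕ) * expectedMarginal f (fun v => thresholdProb l (x v)) u|) ≤
      q * marginal f ∅ u := by
  set p : Fin n → ℝ := fun v => thresholdProb l (x v) with hp
  set g := marginal f ∅ u
  have hp0 : 0 ≤ p := fun v => thresholdProb_nonneg _ _
  have hp1 : p ≤ 1 := fun v => (thresholdProb_le (hx v)).trans (min_le_right _ _)
  have hmg : ∀ S, 0 ≤ marginal f S u ∧ marginal f S u ≤ g := fun S =>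
    ⟨marginal_nonneg hf S u, hs.marginal_anti hf (Finset.empty_subset S) u⟩
  have hg : 0 ≤ g := marginal_nonneg hf ∅ u
  have hw0 : 0 ≤ expectedMarginal f p u := (multilinearExtension_const 0 p).ge.trans
    (multilinearExtension_mono_left (fun S => (hmg S).1) hp0 hp1)
  have hw1 : expectedMarginal f p u ≤ g :=
    (multilinearExtension_mono_left (fun S => (hmg S).2) hp0 hp1).trans
    (multilinearExtension_const g p).le
  set h : (ℕ → Bool) → ℝ := fun ω => marginal f (sampleSet ω 0 l x) u - expectedMarginal f p u
    with hh
  have hsum : ∀ ω : ℕ → Bool, estimate f ω 0 (q ^ 2) l x u -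
      (q ^ 2 : ℕ) * expectedMarginal f p u =
      ∑ j ∈ Finset.range (q ^ 2), h fun i => ω (j * (n * l) + i) := by
    intro ω
    simp only [hh, Finset.sum_sub_distrib, estimate, Finset.sum_const, Finset.card_range,
      nsmul_eq_mul]
    congr 1
    refine Finset.sum_congr rfl fun j _ => ?_
    rw [sampleSet_congr (ω' := fun i => ω (j * (n * l) + i)) (c' := 0)]
    intro i _
    simp
  simp only [hsum]
  -- The q² summands are independent, centred and at most g in absolute value, so the second moment
  -- of their sum is at most q²g².
  refine coinExpect_abs_le (by positivity) ?_
  rw [coinExpect_sq_sum]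
  · have h2 : coinExpect (n * l) (fun ω => h ω ^ 2) ≤ g ^ 2 := by
      refine (coinExpect_mono fun ω => ?_).trans (coinExpect_const _ (g ^ 2)).le
      refine sq_le_sq' ?_ ?_ <;> simp only [hh] <;> linarith [hmg (sampleSet ω 0 l x)]
    rw [mul_pow]
    push_cast
    exact mul_le_mul_of_nonneg_left h2 (by positivity)
  · intro ω ω' hω
    simp only [hh]
    rw [sampleSet_congr (ω' := ω') (c' := 0)]
    simpa using hω
  · rw [coinExpect_sub, coinExpect_const, coinExpect_sampleSet l x fun S => marginal f S u]
    exact sub_self _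

end Sampling

/-! ## Analysis of the algorithm -/

section Analysis

variable {n : ℕ} {f : Finset (Fin n) → ℝ} {P : Set (Fin n → ℝ)}
  {opt : (Fin n → ℝ) → (Fin n → ℝ)}

theorem IsLinearOptimizer.apply_le (hopt : IsLinearOptimizer P opt) {y : Fin n → ℝ} (hy : y ∈ P)
    (u : Fin n) : y u ≤ opt (Pi.single u 1) u := by
  simpa [Pi.single_apply] using (hopt (Pi.single u 1)).2 y hy

/-- The sum over all elements of the largest marginal gain times the largest coordinate. -/
noncomputable def singletonBound (f : Finset (Fin n) → ℝ) (opt : (Fin n → ℝ) → (Fin n → ℝ)) : ℝ :=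
  ∑ u, opt (Pi.single u 1) u * marginal f ∅ u

theorem singletonBound_nonneg (hf : Monotone f) (hP : P ⊆ Set.Icc 0 1)
    (hopt : IsLinearOptimizer P opt) : 0 ≤ singletonBound f opt :=
  Finset.sum_nonneg fun u _ => mul_nonneg ((hP (hopt _).1).1 u) (marginal_nonneg hf ∅ u)

/-- Truncating before a nonnegative step is immaterial if one truncates after it. So the trajectory
can stay untruncated, as feasibility requires, while the analysis follows the truncated point. -/
theorem inf_one_add_inf_one {X z : Fin n → ℝ} (hz : 0 ≤ z) : (X ⊓ 1 + z) ⊓ 1 = (X + z) ⊓ 1 := by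
  funext u
  have := hz u
  simp only [Pi.zero_apply] at this
  simp only [Pi.inf_apply, Pi.add_apply, Pi.one_apply]
  rcases le_total (X u) 1 with h | h
  · rw [min_eq_left h]
  · rw [min_eq_right h, min_eq_right (by linarith), min_eq_right (by linarith)]

theorem le_coinExpect_step (hs : IsSubmodular f) (hf : Monotone f) (hP : P ⊆ Set.Icc 0 1)
    (hopt : IsLinearOptimizer P opt) {δ : ℝ} (hδ0 : 0 ≤ δ) (hδ1 : δ ≤ 1) (hδn : δ * n ≤ 1)
    {q : ℕ} (hq : q ≠ 0) (l : ℕ) {X : Fin n → ℝ} (hX : 0 ≤ X) {O : Finset (Fin n)}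
    (hO : charVec O ∈ P) :
    multilinearExtension f (X ⊓ 1) + δ * (1 - δ * n) * (f O - multilinearExtension f (X ⊓ 1) -
        singletonBound f opt * (2 / q + n * (1 / 2) ^ l)) ≤
      coinExpect (q ^ 2 * (n * l)) fun ω =>
        multilinearExtension f ((X + δ • opt (estimate f ω 0 (q ^ 2) l X)) ⊓ 1) := by
  set x : Fin n → ℝ := X ⊓ 1 with hx
  set p : Fin n → ℝ := fun v => thresholdProb l (X v) with hp
  set c : Fin n → ℝ := fun u => opt (Pi.single u 1) u with hc
  set w : Fin n → ℝ := expectedMarginal f p with hw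
  set κ := δ * (1 - δ * n) with hκ
  have hκ0 : 0 ≤ κ := mul_nonneg hδ0 (by linarith)
  have hx0 : 0 ≤ x := le_inf hX zero_le_one
  have hx1 : x ≤ 1 := inf_le_right
  have hp0 : 0 ≤ p := fun v => thresholdProb_nonneg _ _
  have hpx : p ≤ x := fun v => thresholdProb_le (hX v)
  have hc0 : ∀ u, 0 ≤ c u := fun u => (hP (hopt _).1).1 u
  have hg : ∀ u, 0 ≤ marginal f ∅ u := marginal_nonneg hf ∅
  have hq0 : (0 : ℝ) < q := by positivity
  set Z : (ℕ → Bool) → Fin n → ℝ := fun ω u =>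
    estimate f ω 0 (q ^ 2) l X u - (q ^ 2 : ℕ) * w u with hZ
  -- Samples have probabilities p rather than x; each coordinate is off by at most 2^{-l}.
  have hround : ∀ u, w u ≤ expectedMarginal f x u + n * (1 / 2) ^ l * marginal f ∅ u := by
    intro u
    refine (hs.expectedMarginal_le hf hp0 hpx hx1 u).trans ?_
    refine add_le_add le_rfl (mul_le_mul_of_nonneg_right ?_ (hg u))
    refine (Finset.sum_le_sum fun v _ => le_thresholdProb (hX v)).trans (le_of_eq ?_)
    simp
  have hpoint : ∀ ω, multilinearExtension f x + κ * (f O - multilinearExtension f x -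
      n * (1 / 2) ^ l * singletonBound f opt - 2 / (q : ℝ) ^ 2 * ∑ u, c u * |Z ω u|) ≤
      multilinearExtension f ((X + δ • opt (estimate f ω 0 (q ^ 2) l X)) ⊓ 1) := by
    intro ω
    set y := opt (estimate f ω 0 (q ^ 2) l X) with hy
    have hyP : y ∈ P := (hopt _).1
    have hy0 : 0 ≤ y := (hP hyP).1
    have hyc : ∀ u, y u ≤ c u := hopt.apply_le hyP
    -- Both y and the indicator of O lie below c, so replacing estimated weights by true ones costs
    -- at most ∑ c_u |Z_u| for either.
    have hOc : ∀ u, charVec O u ≤ c u := hopt.apply_le hO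
    have hO0 : 0 ≤ charVec O := (hP hO).1
    have hyδ : 0 ≤ δ • y := fun u => mul_nonneg hδ0 (hy0 u)
    rw [← inf_one_add_inf_one hyδ]
    refine le_trans ?_ (le_multilinearExtension_step hf hx0 hx1 hy0 (hP hyP).2 hδ0 hδ1)
    refine add_le_add le_rfl (mul_le_mul_of_nonneg_left ?_ hκ0)
    have h1 : ∑ u, y u * w u ≤ ∑ u, y u * expectedMarginal f x u +
        n * (1 / 2) ^ l * singletonBound f opt := by
      rw [singletonBound, Finset.mul_sum, ← Finset.sum_add_distrib]
      refine Finset.sum_le_sum fun u _ => ?_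
      have a1 := mul_le_mul_of_nonneg_left (hround u) (hy0 u)
      have a2 : y u * (n * (1 / 2) ^ l * marginal f ∅ u) ≤
          c u * (n * (1 / 2) ^ l * marginal f ∅ u) :=
        mul_le_mul_of_nonneg_right (hyc u) (mul_nonneg (by positivity) (hg u))
      linarith
    have h2 : ∑ u, estimate f ω 0 (q ^ 2) l X u * charVec O u ≤
        ∑ u, estimate f ω 0 (q ^ 2) l X u * y u := (hopt _).2 _ hO
    have h3 : (q : ℝ) ^ 2 * ∑ u, charVec O u * w u ≤
        ∑ u, estimate f ω 0 (q ^ 2) l X u * charVec O u + ∑ u, c u * |Z ω u| := by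
      rw [Finset.mul_sum, ← Finset.sum_add_distrib]
      refine Finset.sum_le_sum fun u _ => ?_
      have a1 := mul_le_mul_of_nonneg_right (hOc u) (abs_nonneg (Z ω u))
      have a2 := mul_le_mul_of_nonneg_left (neg_abs_le (Z ω u)) (hO0 u)
      simp only [hZ] at a1 a2 ⊢
      push_cast at a1 a2 ⊢
      linarith
    have h4 : ∑ u, estimate f ω 0 (q ^ 2) l X u * y u ≤
        (q : ℝ) ^ 2 * ∑ u, y u * w u + ∑ u, c u * |Z ω u| := by
      rw [Finset.mul_sum, ← Finset.sum_add_distrib]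
      refine Finset.sum_le_sum fun u _ => ?_
      have a1 := mul_le_mul_of_nonneg_right (hyc u) (abs_nonneg (Z ω u))
      have a2 := mul_le_mul_of_nonneg_left (le_abs_self (Z ω u)) (hy0 u)
      simp only [hZ] at a1 a2 ⊢
      push_cast at a1 a2 ⊢
      linarith
    have h5 : f O ≤ multilinearExtension f x + ∑ u, charVec O u * w u := by
      have a1 := hs.le_add_sum_expectedMarginal hf O hp0 (hpx.trans hx1)
      have a2 := multilinearExtension_mono_right hf hp0 hpx hx1
      have a3 : ∑ u, charVec O u * w u = ∑ u ∈ O, expectedMarginal f p u := by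
        simp [charVec, hw]
      linarith
    -- The factor 2 counts the estimation error once at O and once at y; dividing by q² undoes the
    -- summation over samples.
    have h6 : ∑ u, charVec O u * w u ≤ ∑ u, y u * w u +
        2 / (q : ℝ) ^ 2 * ∑ u, c u * |Z ω u| := by
      have hq2 : (0 : ℝ) < (q : ℝ) ^ 2 := by positivity
      rw [← mul_le_mul_iff_right₀ hq2, mul_add, ← mul_assoc, mul_div_cancel₀ _ hq2.ne']
      linarith
    linarith
  refine le_trans ?_ (coinExpect_mono hpoint)
  rw [coinExpect_add, coinExpect_const, coinExpect_const_mul, coinExpect_sub, coinExpect_const,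
    coinExpect_const_mul, coinExpect_sum]
  refine add_le_add le_rfl (mul_le_mul_of_nonneg_left ?_ hκ0)
  have h7 : ∑ u, coinExpect (q ^ 2 * (n * l)) (fun ω => c u * |Z ω u|) ≤
      q * singletonBound f opt := by
    rw [singletonBound, Finset.mul_sum]
    refine Finset.sum_le_sum fun u _ => ?_
    rw [coinExpect_const_mul]
    refine (mul_le_mul_of_nonneg_left
      (coinExpect_abs_estimate_sub_le hs hf q l hX u) (hc0 u)).trans (le_of_eq ?_)
    simp only [hc]
    ring
  have h8 := mul_le_mul_of_nonneg_left h7 (show 0 ≤ 2 / (q : ℝ) ^ 2 by positivity)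
  have h9 : 2 / (q : ℝ) ^ 2 * (q * singletonBound f opt) = singletonBound f opt * (2 / q) := by
    field_simp
  rw [h9] at h8
  linarith

theorem greedy_congr {ω ω' : ℕ → Bool} (δ : ℝ) (m l i : ℕ)
    (h : ∀ j < i * (m * (n * l)), ω j = ω' j) :
    greedy f opt ω δ m l i = greedy f opt ω' δ m l i := by
  induction i with
  | zero => rfl
  | succ i ih =>
    rw [greedy, greedy, ih fun j hj => h j (hj.trans_le (Nat.mul_le_mul_right _ i.le_succ)),
      estimate_congr (ω' := ω') (c' := i * (m * (n * l)))]
    intro j hj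
    exact h _ (by rw [Nat.succ_mul]; omega)

theorem greedy_mono (hP : P ⊆ Set.Icc 0 1) (hopt : IsLinearOptimizer P opt) (ω : ℕ → Bool)
    {δ : ℝ} (hδ0 : 0 ≤ δ) (m l : ℕ) : Monotone (greedy f opt ω δ m l) :=
  monotone_nat_of_le_succ fun _ => le_add_of_nonneg_right fun u =>
    mul_nonneg hδ0 ((hP (hopt _).1).1 u)

/-- Conditioned on the coins of the first N rounds, a round moves the value the fraction κ of the
way to f(O) - ν. The recursion a' ≥ (1 - κ)a + κ(f(O) - ν) starts from a ≥ 0, and ν enters only once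
in total. -/
theorem le_coinExpect_greedy (h0 : ∀ S, 0 ≤ f S) (hs : IsSubmodular f) (hf : Monotone f)
    (hP : P ⊆ Set.Icc 0 1) (hopt : IsLinearOptimizer P opt) {δ : ℝ} (hδ0 : 0 ≤ δ) (hδ1 : δ ≤ 1)
    (hδn : δ * n ≤ 1) {q : ℕ} (hq : q ≠ 0) (l : ℕ) {O : Finset (Fin n)} (hO : charVec O ∈ P)
    (N : ℕ) :
    f O * (1 - (1 - δ * (1 - δ * n)) ^ N) - singletonBound f opt * (2 / q + n * (1 / 2) ^ l) ≤
      coinExpect (N * (q ^ 2 * (n * l))) fun ω =>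
        multilinearExtension f (greedy f opt ω δ (q ^ 2) l N ⊓ 1) := by
  set κ := δ * (1 - δ * n) with hκ
  set ν := singletonBound f opt * (2 / q + n * (1 / 2) ^ l) with hν
  have hν0 : 0 ≤ ν := mul_nonneg (singletonBound_nonneg hf hP hopt) (by positivity)
  have hκ1 : κ ≤ 1 := by
    refine (mul_le_mul hδ1 (?_ : 1 - δ * n ≤ 1) (by linarith) zero_le_one).trans_eq (one_mul 1)
    have : 0 ≤ δ * n := by positivity
    linarith
  induction N with
  | zero =>
    simp only [pow_zero, sub_self, mul_zero]
    refine le_trans ?_ ((coinExpect_const _ 0).ge.trans (coinExpect_mono fun ω => ?_))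
    · linarith
    · rw [greedy, inf_eq_left.2 (zero_le_one' (Fin n → ℝ)), multilinearExtension_zero]
      exact h0 _
  | succ N ih =>
    set B := q ^ 2 * (n * l) with hB
    set a := coinExpect (N * B) fun ω =>
        multilinearExtension f (greedy f opt ω δ (q ^ 2) l N ⊓ 1) with ha
    have hstep : a + κ * (f O - a - ν) ≤ coinExpect ((N + 1) * B) fun ω =>
        multilinearExtension f (greedy f opt ω δ (q ^ 2) l (N + 1) ⊓ 1) := by
      rw [Nat.succ_mul, coinExpect_split]
      have hinner : ∀ ω, multilinearExtension f (greedy f opt ω δ (q ^ 2) l N ⊓ 1) +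
          κ * (f O - multilinearExtension f (greedy f opt ω δ (q ^ 2) l N ⊓ 1) - ν) ≤
          coinExpect B fun ω' => multilinearExtension f
            (greedy f opt (glueCoins (N * B) ω ω') δ (q ^ 2) l (N + 1) ⊓ 1) := by
        intro ω
        have e : ∀ ω', greedy f opt (glueCoins (N * B) ω ω') δ (q ^ 2) l (N + 1) =
            greedy f opt ω δ (q ^ 2) l N +
              δ • opt (estimate f ω' 0 (q ^ 2) l (greedy f opt ω δ (q ^ 2) l N)) := by
          intro ω'
          rw [greedy, greedy_congr (ω' := ω) δ (q ^ 2) l N fun j hj => glueCoins_of_lt hj _ _,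
            estimate_congr (ω' := ω') (c' := 0)]
          intro i _
          rw [zero_add]
          exact glueCoins_add _ _ _ _
        simp only [e]
        exact le_coinExpect_step hs hf hP hopt hδ0 hδ1 hδn hq l
          (greedy_mono hP hopt ω hδ0 _ _ (Nat.zero_le N)) hO
      refine le_trans (le_of_eq ?_) (coinExpect_mono hinner)
      rw [coinExpect_add, coinExpect_const_mul, coinExpect_sub, coinExpect_sub, coinExpect_const,
        coinExpect_const]
    refine le_trans ?_ hstep
    have := mul_le_mul_of_nonneg_left ih (sub_nonneg.2 hκ1)
    rw [pow_succ]
    nlinarith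

/-- The first round has exact weights, and its maximizer y beats, for each u, the point of P with
the largest u-coordinate; hence M ≤ n⟨y, f(· | ∅)⟩. The value gained in that round is never lost, by
monotonicity. -/
theorem singletonBound_le_greedy (h0 : ∀ S, 0 ≤ f S) (hf : Monotone f)
    (hP : P ⊆ Set.Icc 0 1) (hopt : IsLinearOptimizer P opt) {δ : ℝ} (hδ0 : 0 ≤ δ) (hδ1 : δ ≤ 1)
    (hδn : δ * n ≤ 1) {m : ℕ} (hm : m ≠ 0) (l : ℕ) {N : ℕ} (hN : N ≠ 0) (ω : ℕ → Bool) :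
    δ * (1 - δ * n) * singletonBound f opt ≤
      n * multilinearExtension f (greedy f opt ω δ m l N ⊓ 1) := by
  set y := opt ((m : ℝ) • marginal f ∅) with hy
  have hg1 : greedy f opt ω δ m l 1 = 0 + δ • y := by
    rw [greedy, greedy, estimate_zero]
  have h1 : δ * (1 - δ * n) * ∑ u, y u * marginal f ∅ u ≤
      multilinearExtension f (greedy f opt ω δ m l N ⊓ 1) := by
    have a1 := le_multilinearExtension_step hf (le_refl (0 : Fin n → ℝ)) zero_le_one
      (hP (hopt ((m : ℝ) • marginal f ∅)).1).1 (hP (hopt ((m : ℝ) • marginal f ∅)).1).2 hδ0 hδ1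
    simp only [expectedMarginal_zero, multilinearExtension_zero, ← hy, ← hg1] at a1
    have hmono := greedy_mono (f := f) hP hopt ω hδ0 m l
    have a2 := multilinearExtension_mono_right hf
      (le_inf (hmono (Nat.zero_le 1)) zero_le_one)
      (inf_le_inf_right 1 (hmono (Nat.one_le_iff_ne_zero.2 hN))) inf_le_right
    linarith [h0 ∅]
  have hκ0 : 0 ≤ δ * (1 - δ * n) := mul_nonneg hδ0 (by linarith)
  have h2 : ∀ u, opt (Pi.single u 1) u * marginal f ∅ u ≤ ∑ v, y v * marginal f ∅ v := by
    intro u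
    have a1 := (hopt ((m : ℝ) • marginal f ∅)).2 _ (hopt (Pi.single u 1)).1
    simp only [Pi.smul_apply, smul_eq_mul, mul_assoc, ← Finset.mul_sum] at a1
    have a2 := le_of_mul_le_mul_left a1 (by positivity)
    refine le_trans (le_trans (le_of_eq (mul_comm _ _)) ?_) (a2.trans (le_of_eq ?_))
    · exact Finset.single_le_sum (f := fun v => marginal f ∅ v * opt (Pi.single u 1) v)
        (fun v _ => mul_nonneg (marginal_nonneg hf ∅ v) ((hP (hopt _).1).1 v)) (Finset.mem_univ u)
    · exact Finset.sum_congr rfl fun v _ => mul_comm _ _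
  have h3 : singletonBound f opt ≤ n * ∑ v, y v * marginal f ∅ v := by
    refine (Finset.sum_le_sum fun u _ => h2 u).trans (le_of_eq ?_)
    simp
  calc _ ≤ δ * (1 - δ * n) * (n * ∑ v, y v * marginal f ∅ v) :=
        mul_le_mul_of_nonneg_left h3 hκ0
    _ = n * (δ * (1 - δ * n) * ∑ v, y v * marginal f ∅ v) := by ring
    _ ≤ _ := mul_le_mul_of_nonneg_left h1 (Nat.cast_nonneg n)

/-- The trajectory of the algorithm is a scaled sum of points of `P`. -/
theorem exists_greedy_eq_smul (hP : Convex ℝ P) (hopt : IsLinearOptimizer P opt) (ω : ℕ → Bool)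
    (δ : ℝ) (m l N : ℕ) : ∃ y ∈ P, greedy f opt ω δ m l (N + 1) = (δ * (N + 1 : ℕ)) • y := by
  induction N with
  | zero => exact ⟨_, (hopt (estimate f ω 0 m l 0)).1, by simp [greedy]⟩
  | succ N ih =>
    obtain ⟨y, hy, e⟩ := ih
    rw [greedy, e]
    set y' := opt (estimate f ω ((N + 1) * (m * (n * l))) m l ((δ * (N + 1 : ℕ)) • y))
    have hN : (0 : ℝ) < (N + 1 : ℕ) + 1 := by positivity
    -- The running average of the oracle answers, which has equal weights because the step size is
    -- constant.
    refine ⟨(((N + 1 : ℕ) : ℝ) / ((N + 1 : ℕ) + 1)) • y + (1 / (((N + 1 : ℕ) : ℝ) + 1)) • y',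
      hP hy (hopt _).1 (by positivity) (by positivity) (by field_simp), ?_⟩
    rw [smul_add, smul_smul, smul_smul]
    congr 2
    · push_cast at hN ⊢
      field_simp
    · push_cast at hN ⊢
      field_simp

end Analysis

/-! ### Choice of parameters and the final estimate -/

theorem mainTheorem12 (ε : ℝ) (hε₀ : 0 < ε) (hε₁ : ε ≤ 1 / Real.exp 1) :
    ∃ (A : Prog) (p : Polynomial ℕ) (err : ℕ → ℝ),
      Tendsto err atTop (𝓝 0) ∧
      IsBicriteriaIntegerApprox A ε (Real.log (1 / ε)) (fun n => p.eval n)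
        (fun n => 1 - ε - err n) (Real.log (1 / ε)) := by
  set T := Real.log (1 / ε) with hT
  have hT1 : 1 ≤ T := by
    rw [hT, Real.le_log_iff_exp_le (by positivity)]
    rw [le_div_iff₀ (Real.exp_pos 1)] at hε₁
    rw [le_div_iff₀ hε₀]
    linarith
  have hexpT : Real.exp (-T) = ε := by
    rw [hT, Real.exp_neg, Real.exp_log (by positivity)]
    simp
  obtain ⟨p, hp⟩ : ∃ p : Polynomial ℕ, ∀ n, p.eval n =
      14 + 2 * (n + 1) + 2 * (n + 1) ^ 2 + 2 * (n + 1) ^ 4 + n * 4 + (n + 1) ^ 2 * (5 + n * 6 +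
        (n + 1) ^ 8 * (n + 4 + n * (4 + (n + 1) ^ 8 * 4) + n * (n + 7))) :=
    ⟨14 + 2 * (.X + 1) + 2 * (.X + 1) ^ 2 + 2 * (.X + 1) ^ 4 + .X * 4 + (.X + 1) ^ 2 *
      (5 + .X * 6 + (.X + 1) ^ 8 * (.X + 4 + .X * (4 + (.X + 1) ^ 8 * 4) + .X * (.X + 7))), by
      intro n
      simp [Polynomial.eval_add, Polynomial.eval_mul, Polynomial.eval_pow]⟩
  have hlim : Tendsto (fun n : ℕ => 1 / ((n : ℝ) + 1)) atTop (𝓝 0) :=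
    tendsto_one_div_add_atTop_nhds_zero_nat
  -- For the finitely many n with n + 1 < 2T the error 1 makes the guarantee trivial. For the others
  -- δn ≤ 1/2; the first term of the error comes from (1 - κ)^k and the second from sampling.
  refine ⟨greedyProg, p, fun n => if 2 * T ≤ n + 1 then
    ε * (Real.exp (T ^ 2 * (1 / (n + 1))) - 1) + 6 * (1 / (n + 1)) else 1, ?_, ?_⟩
  · have h1 : Tendsto (fun n : ℕ => ε * (Real.exp (T ^ 2 * (1 / ((n : ℝ) + 1))) - 1) +
        6 * (1 / ((n : ℝ) + 1))) atTop (𝓝 0) := by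
      have h2 := (((Real.continuous_exp.tendsto _).comp (hlim.const_mul (T ^ 2))).sub_const
        1).const_mul ε
      simpa using h2.add (hlim.const_mul 6)
    refine h1.congr' ?_
    filter_upwards [eventually_ge_atTop ⌈2 * T⌉₊] with n hn
    rw [if_pos]
    linarith [Nat.ceil_le.1 hn]
  · intro n f P opt h0 hf hs hP hconv hopt
    have hk0 : (0 : ℝ) < ((n + 1) ^ 2 : ℕ) := by positivity
    set δ : ℝ := T / ((n + 1) ^ 2 : ℕ) with hδ
    have hδ0 : 0 ≤ δ := by positivity
    have hout : ∀ ω : Fin (p.eval n) → Bool, greedyProg.output f opt ε T ω =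
        greedy f opt (extendCoins ω) δ ((n + 1) ^ 8) ((n + 1) ^ 8) ((n + 1) ^ 2) ⊓ 1 :=
      fun ω => (greedyProg_exec ε T).1
    refine ⟨fun ω => ?_, fun ω => ?_, fun O hO => ?_⟩
    · rw [Prog.runTime, Prog.run, (greedyProg_exec ε T).2]
      exact (hp n).ge
    · dsimp only
      rw [hout]
      obtain ⟨y, hy, e⟩ := exists_greedy_eq_smul (f := f) hconv hopt (extendCoins ω) δ
        ((n + 1) ^ 8) ((n + 1) ^ 8) (n * (n + 2))
      rw [show n * (n + 2) + 1 = (n + 1) ^ 2 by ring, hδ, div_mul_cancel₀ _ hk0.ne'] at e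
      rw [← hδ] at e
      rw [e]
      have hy0 := (hP hy).1
      have hy1 := (hP hy).2
      refine ⟨⟨le_inf (fun u => mul_nonneg (by linarith) (hy0 u)) zero_le_one, inf_le_right⟩,
        y, hy, y, hy, le_inf (fun u => ?_) hy1, inf_le_left⟩
      exact le_mul_of_one_le_left (hy0 u) hT1
    · simp only [hout]
      change _ ≤ coinExpect (p.eval n) fun ω => multilinearExtension f
        (greedy f opt ω δ ((n + 1) ^ 8) ((n + 1) ^ 8) ((n + 1) ^ 2) ⊓ 1)
      have hfO := h0 O
      have hpos : ∀ ω, 0 ≤ multilinearExtension f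
          (greedy f opt ω δ ((n + 1) ^ 8) ((n + 1) ^ 8) ((n + 1) ^ 2) ⊓ 1) := by
        intro ω
        refine (multilinearExtension_const 0 _).ge.trans (multilinearExtension_mono_left h0
          (le_inf (greedy_mono hP hopt ω hδ0 _ _ (Nat.zero_le _)) zero_le_one) inf_le_right)
      have hpos' := (coinExpect_const (p.eval n) 0).ge.trans (coinExpect_mono hpos)
      split_ifs with hn
      swap
      · refine le_trans ?_ hpos'
        nlinarith
      have hn1 : (0 : ℝ) < n + 1 := by positivity
      have hδn1 : δ * (n + 1) = T / (n + 1) := by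
        rw [hδ]; push_cast; field_simp
      have hhalf : T / (n + 1) ≤ 1 / 2 := by
        rw [div_le_iff₀ hn1]; linarith
      have hδn : δ * n ≤ 1 / 2 := by nlinarith
      have hδ1 : δ ≤ 1 := by nlinarith [Nat.cast_nonneg (α := ℝ) n]
      have hq : (n + 1) ^ 4 ≠ 0 := by positivity
      -- The number of coins used is at most the number of steps.
      have hcoins : (n + 1) ^ 2 * ((n + 1) ^ 8 * (n * (n + 1) ^ 8)) ≤ p.eval n := by
        rw [hp]
        have : (n + 1) ^ 8 * (n * (n + 1) ^ 8) ≤ 5 + n * 6 +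
          (n + 1) ^ 8 * (n + 4 + n * (4 + (n + 1) ^ 8 * 4) + n * (n + 7)) := by
          refine le_trans (Nat.mul_le_mul_left _ ?_) (Nat.le_add_left _ _)
          nlinarith [Nat.zero_le (n * (n + 1) ^ 8)]
        exact le_trans (Nat.mul_le_mul_left _ this) (Nat.le_add_left _ _)
      set a := coinExpect (p.eval n) fun ω => multilinearExtension f
        (greedy f opt ω δ ((n + 1) ^ 8) ((n + 1) ^ 8) ((n + 1) ^ 2) ⊓ 1) with ha
      have hmain := le_coinExpect_greedy h0 hs hf hP hopt hδ0 hδ1 (by linarith) hq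
        ((n + 1) ^ 8) hO.1 ((n + 1) ^ 2)
      rw [show ((n + 1) ^ 4) ^ 2 = (n + 1) ^ 8 by ring, ← coinExpect_eq_of_le hcoins _
        fun ω ω' h => by rw [greedy_congr δ _ _ _ h], ← ha] at hmain
      set M := singletonBound f opt with hM
      have hM0 : 0 ≤ M := singletonBound_nonneg hf hP hopt
      set κ := δ * (1 - δ * n) with hκ
      have hfirst : κ * M ≤ n * a := by
        rw [ha, ← coinExpect_const_mul]
        exact (coinExpect_const _ _).ge.trans (coinExpect_mono fun ω =>
          singletonBound_le_greedy h0 hf hP hopt hδ0 hδ1 (by linarith) (by positivity) _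
            (by positivity) ω)
      have hκ1 : κ ≤ 1 := by nlinarith [Nat.cast_nonneg (α := ℝ) n]
      have hκ2 : 1 / (2 * ((n : ℝ) + 1) ^ 2) ≤ κ := by
        have : 1 / ((n : ℝ) + 1) ^ 2 ≤ δ := by
          rw [hδ]; push_cast; gcongr
        have e : 1 / (2 * ((n : ℝ) + 1) ^ 2) = 1 / ((n : ℝ) + 1) ^ 2 * (1 / 2) := by
          field_simp
        rw [e]
        exact mul_le_mul this (by linarith) (by norm_num) hδ0
      have hpow : (1 - κ) ^ ((n + 1) ^ 2) ≤ ε * Real.exp (T ^ 2 * (1 / (n + 1))) := by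
        calc (1 - κ) ^ ((n + 1) ^ 2) ≤ Real.exp (-κ) ^ ((n + 1) ^ 2) :=
              pow_le_pow_left₀ (by linarith) (by linarith [Real.add_one_le_exp (-κ)]) _
          _ = Real.exp (-T + T * (δ * n)) := by
              rw [← Real.exp_nat_mul]
              congr 1
              have : δ * ((n + 1) ^ 2 : ℕ) = T := div_mul_cancel₀ _ hk0.ne'
              rw [hκ]
              linear_combination (-(1 - δ * n)) * this
          _ ≤ Real.exp (-T + T ^ 2 * (1 / (n + 1))) := by
              refine Real.exp_le_exp.2 (add_le_add le_rfl ?_)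
              have : δ * n ≤ T / (n + 1) := by nlinarith
              calc T * (δ * n) ≤ T * (T / (n + 1)) :=
                    mul_le_mul_of_nonneg_left this (by linarith)
                _ = _ := by ring
          _ = _ := by rw [Real.exp_add, hexpT]
      set ρ : ℝ := 2 / ((n + 1) ^ 4 : ℕ) + n * (1 / 2) ^ ((n + 1) ^ 8) with hρ
      have hρ0 : 0 ≤ ρ := by positivity
      have hρ1 : ρ ≤ 3 / ((n : ℝ) + 1) ^ 4 := by
        have a1 : ((1 : ℝ) / 2) ^ ((n + 1) ^ 8) ≤ 1 / ((n : ℝ) + 1) ^ 8 := by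
          rw [one_div_pow]
          refine one_div_le_one_div_of_le (by positivity) ?_
          have := (Nat.lt_two_pow_self (n := (n + 1) ^ 8)).le
          exact_mod_cast this
        have a2 : (n : ℝ) * (1 / 2) ^ ((n + 1) ^ 8) ≤ 1 / ((n : ℝ) + 1) ^ 4 := by
          calc (n : ℝ) * (1 / 2) ^ ((n + 1) ^ 8) ≤ ((n : ℝ) + 1) ^ 4 * (1 / ((n : ℝ) + 1) ^ 8) := by
                refine mul_le_mul ?_ a1 (by positivity) (by positivity)
                have : (n : ℝ) + 1 ≤ ((n : ℝ) + 1) ^ 4 :=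
                  le_self_pow₀ (by linarith [Nat.cast_nonneg (α := ℝ) n]) (by norm_num)
                linarith
            _ = _ := by field_simp
        rw [hρ]
        push_cast
        calc _ ≤ 2 / ((n : ℝ) + 1) ^ 4 + 1 / ((n : ℝ) + 1) ^ 4 := add_le_add le_rfl a2
          _ = _ := by ring
      -- Comparing M with the output costs a factor 2(n+1)³, which is why q = (n+1)⁴, that is (n+1)⁸
      -- samples, is enough.
      have hMρ : M * ρ ≤ 6 * (1 / ((n : ℝ) + 1)) * a := by
        have a1 : 1 / (2 * ((n : ℝ) + 1) ^ 2) * M ≤ (n + 1) * a :=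
          (mul_le_mul_of_nonneg_right hκ2 hM0).trans (hfirst.trans (by nlinarith))
        have a2 : M ≤ 2 * ((n : ℝ) + 1) ^ 3 * a := by
          rw [div_mul_eq_mul_div, one_mul, div_le_iff₀ (by positivity)] at a1
          linarith
        calc M * ρ ≤ 2 * ((n : ℝ) + 1) ^ 3 * a * (3 / ((n : ℝ) + 1) ^ 4) :=
              mul_le_mul a2 hρ1 hρ0 (by positivity)
          _ = _ := by field_simp; ring
      -- The error is relative to a, so it becomes relative to f(O) only when a ≤ f(O); otherwise
      -- the claim is immediate.
      rcases le_total (f O) a with hle | hle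
      · refine le_trans ?_ hle
        have b1 : 1 ≤ Real.exp (T ^ 2 * (1 / ((n : ℝ) + 1))) := Real.one_le_exp (by positivity)
        have b2 : 0 ≤ 6 * (1 / ((n : ℝ) + 1)) := by positivity
        have b3 : 0 ≤ ε * (Real.exp (T ^ 2 * (1 / ((n : ℝ) + 1))) - 1) :=
          mul_nonneg hε₀.le (by linarith)
        exact mul_le_of_le_one_left hfO (by linarith)
      · have b1 := mul_le_mul_of_nonneg_left hle (show 0 ≤ 6 * (1 / ((n : ℝ) + 1)) by positivity)
        have b2 := mul_le_mul_of_nonneg_left hpow hfO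
        linarith
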